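/- Let $Q$ be a finite acyclic quiver and $\mathcal{A}$ an abelian category; let $[Q,\mathcal{A}]$ be the abelian category of representations of $Q$ in $\mathcal{A}$. For a vertex $i$ let $\mathsf{P}_i,\mathsf{I}_i\colon\mathcal{A}\to[Q,\mathcal{A}]$ be the left and right adjoint of evaluation at $i$, so $\mathsf{P}_i(A)_j=\bigoplus_{i\leadsto j}A$ and $\mathsf{I}_i(A)_j=\bigoplus_{j\leadsto i}A$ (sums over paths). For a class $\mathcal{X}$ of objects of an abelian category, $\operatorname{add}\mathcal{X}$, $\operatorname{Fac}\mathcal{X}$, $\operatorname{Sub}\mathcal{X}$ consist of the direct summands, factor objects, and subobjects of finite direct sums of objects of $\mathcal{X}$; $\mathcal{X}^{\perp}$, ${}^{\perp}\mathcal{X}$ are the right and left $\operatorname{Hom}$-orthogonals, and $\mathcal{X}^{\perp_1}$, ${}^{\perp_1}\mathcal{X}$ the right and left $\operatorname{Ext}^1$-orthogonals. $[Q,\operatorname{Proj}\mathcal{A}]$ and $[Q,\operatorname{Inj}\mathcal{A}]$ are the full subcategories of representations that are projective, respectively injective, in $\mathcal{A}$ at every vertex. For an additive category $\mathcal{E}$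 and a full subcategory $\mathcal{X}$ closed under finite direct sums, $\mathcal{E}/\mathcal{X}$ has the objects of $\mathcal{E}$ and morphisms modulo those factoring through an object of $\mathcal{X}$. A pair $(\mathcal{T},\mathcal{F})$ is a torsion pair if $\operatorname{Hom}(\mathcal{T},\mathcal{F})=0$ and every $X$ has a short exact sequence $0\to\mathsf{t}X\to X\to\mathsf{f}X\to0$ with $\mathsf{t}X\in\mathcal{T}$, $\mathsf{f}X\in\mathcal{F}$; this makes $\mathsf{t},\mathsf{f}$ functors to $\mathcal{T},\mathcal{F}$. A pair $(\mathcal{C},\mathcal{D})$ is a cotorsion pair if $\mathcal{C}={}^{\perp_1}\mathcal{D}$, $\mathcal{D}=\mathcal{C}^{\perp_1}$ and every $X$ has short exact sequences $0\to\mathsf{d}X\to\mathsf{c}X\to X\to0$ and $0\to X\to\tilde{\mathsf{d}}X\to\tilde{\mathsf{c}}X\to0$ with $\mathsf{c}X,\tilde{\mathsf{c}}X\in\mathcal{C}$ and $\mathsf{d}X,\tilde{\mathsf{d}}X\in\mathcal{D}$; lifting, respectively extending, morphisms makes $\mathsf{c}$ and $\tilde{\mathsf{d}}$ functors to $\mathcal{C}/(\mathcal{C}\cap\mathcal{D})$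 and $\mathcal{D}/(\mathcal{C}\cap\mathcal{D})$. In an abelian category with enough projectives, a full subcategory $\mathbb{T}$ closed under finite direct sums and summands is tilting if $\operatorname{Ext}^1(\mathbb{T},\mathbb{T})=0$, every object of $\mathbb{T}$ has projective dimension at most $1$, every projective $P$ has a short exact sequence $0\to P\to T^0\to T^1\to0$ with $T^i\in\mathbb{T}$, and $\mathbb{T}$ is contravariantly finite (every object has a right $\mathbb{T}$-approximation). Cotilting is the dual notion, in an abelian category with enough injectives. **Theorem.** (1) Suppose $\mathcal{A}$ has enough projectives, and put $\mathbb{T}=\operatorname{add}\{\mathsf{I}_i(P)\mid i\in Q_0,\ P\in\operatorname{Proj}\mathcal{A}\}$. Then $[Q,\mathcal{A}]$ has enough projectives, $\mathbb{T}$ is tilting in $[Q,\mathcal{A}]$, and $$[Q,\operatorname{Proj}\mathcal{A}]=\{X\in{}^{\perp_1}\mathbb{T}\mid\operatorname{pdim}X\le1\}.$$ Moreover $([Q,\operatorname{Proj}\mathcal{A}],\operatorname{Fac}\mathbb{T})$ is a cotorsion pair, $(\operatorname{Fac}\mathbb{T},\mathbb{T}^{\perp})$ is a torsion pair, $[Q,\operatorname{Proj}\mathcal{A}]\cap\operatorname{Fac}\mathbb{T}=\mathbb{T}$,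 and the functors $\mathsf{f}$ and $\mathsf{c}$ of these pairs induce mutually inverse equivalences $$[Q,\operatorname{Proj}\mathcal{A}]/\mathbb{T}\simeq\mathbb{T}^{\perp}.$$ (2) Suppose $\mathcal{A}$ has enough injectives, and put $\mathbb{C}=\operatorname{add}\{\mathsf{P}_i(I)\mid i\in Q_0,\ I\in\operatorname{Inj}\mathcal{A}\}$. Then $[Q,\mathcal{A}]$ has enough injectives, $\mathbb{C}$ is cotilting in $[Q,\mathcal{A}]$, and $$[Q,\operatorname{Inj}\mathcal{A}]=\{X\in\mathbb{C}^{\perp_1}\mid\operatorname{idim}X\le1\}.$$ Moreover $({}^{\perp}\mathbb{C},\operatorname{Sub}\mathbb{C})$ is a torsion pair, $(\operatorname{Sub}\mathbb{C},[Q,\operatorname{Inj}\mathcal{A}])$ is a cotorsion pair, $\operatorname{Sub}\mathbb{C}\cap[Q,\operatorname{Inj}\mathcal{A}]=\mathbb{C}$, and the functors $\mathsf{t}$ and $\tilde{\mathsf{d}}$ of these pairs induce mutually inverse equivalences $$[Q,\operatorname{Inj}\mathcal{A}]/\mathbb{C}\simeq{}^{\perp}\mathbb{C}.$$ -/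

import Mathlib

open CategoryTheory CategoryTheory.Limits

universe w' w v u

namespace QuiverTilting

noncomputable section

/-! ### Subcategories of an abelian category -/

section Abelian

variable {A : Type u} [Category.{v} A] [Abelian A]

/-- `0 ⟶ X ⟶ Y ⟶ Z ⟶ 0` is a short exact sequence. -/
def IsSES {X Y Z : A} (i : X ⟶ Y) (p : Y ⟶ Z) : Prop :=
  ∃ w : i ≫ p = 0, (ShortComplex.mk i p w).ShortExact

attribute [local instance] Abelian.hasFiniteBiproducts

/-- `Y` is a finite (possibly empty) direct sum of objects of `S`. -/
def IsFiniteSumOf (S : ObjectProperty A) (Y : A) : Prop :=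
  ∃ (n : ℕ) (f : Fin n → A), (∀ k, S (f k)) ∧ Nonempty (Y ≅ ⨁ f)

/-- `add S`: direct summands of finite direct sums of objects of `S`. -/
def addClosure (S : ObjectProperty A) : ObjectProperty A :=
  fun X => ∃ Y, IsFiniteSumOf S Y ∧ Nonempty (Retract X Y)

/-- `Fac S` (written `FacCat S`): factor objects of finite direct sums of objects of `S`. -/
def FacCat (S : ObjectProperty A) : ObjectProperty A :=
  fun X => ∃ Y, IsFiniteSumOf S Y ∧ ∃ p : Y ⟶ X, Epi p

/-- `Sub S` (written `SubCat S`): subobjects of finite direct sums of objects of `S`. -/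
def SubCat (S : ObjectProperty A) : ObjectProperty A :=
  fun X => ∃ Y, IsFiniteSumOf S Y ∧ ∃ i : X ⟶ Y, Mono i

/-- `Ext¹(X, Y) = 0`. -/
def ExtOneVanishes (X Y : A) : Prop :=
  letI := HasExt.standard A
  Subsingleton (Abelian.Ext.{max u v} X Y 1)

/-- The right `Ext¹`-orthogonal: all `Y` with `Ext¹(X, Y) = 0` for all `X` in `S`. -/
def rightExtOrthogonal (S : ObjectProperty A) : ObjectProperty A :=
  fun Y => ∀ X, S X → ExtOneVanishes X Y

/-- The left `Ext¹`-orthogonal: all `X` with `Ext¹(X, Y) = 0` for all `Y` in `S`. -/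
def leftExtOrthogonal (S : ObjectProperty A) : ObjectProperty A :=
  fun X => ∀ Y, S Y → ExtOneVanishes X Y

/-- Projective dimension at most one. -/
def ProjDimLEOne : ObjectProperty A :=
  fun X => ∃ (P₁ P₀ : A) (i : P₁ ⟶ P₀) (p : P₀ ⟶ X), Projective P₁ ∧ Projective P₀ ∧ IsSES i p

/-- Injective dimension at most one. -/
def InjDimLEOne : ObjectProperty A :=
  fun X => ∃ (I₀ I₁ : A) (i : X ⟶ I₀) (p : I₀ ⟶ I₁), Injective I₀ ∧ Injective I₁ ∧ IsSES i p

/-- Every object has a right `S`-approximation. -/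
def ContravariantlyFinite (S : ObjectProperty A) : Prop :=
  ∀ E : A, ∃ (X : A) (φ : X ⟶ E), S X ∧
    ∀ (X' : A) (f : X' ⟶ E), S X' → ∃ g : X' ⟶ X, g ≫ φ = f

/-- Every object has a left `S`-approximation. -/
def CovariantlyFinite (S : ObjectProperty A) : Prop :=
  ∀ E : A, ∃ (X : A) (ψ : E ⟶ X), S X ∧
    ∀ (X' : A) (f : E ⟶ X'), S X' → ∃ g : X ⟶ X', ψ ≫ g = f

/-- Tilting subcategories (of an abelian category with enough projectives). -/
structure IsTilting (T : ObjectProperty A) : Prop where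
  add_closed : ∀ X, addClosure T X → T X
  ext_vanishes : ∀ X Y, T X → T Y → ExtOneVanishes X Y
  projDim_le_one : ∀ X, T X → ProjDimLEOne X
  coresolution : ∀ P : A, Projective P →
    ∃ (T₀ T₁ : A) (i : P ⟶ T₀) (p : T₀ ⟶ T₁), T T₀ ∧ T T₁ ∧ IsSES i p
  contravariantlyFinite : ContravariantlyFinite T

/-- Cotilting subcategories (of an abelian category with enough injectives). -/
structure IsCotilting (C : ObjectProperty A) : Prop where
  add_closed : ∀ X, addClosure C X → C X
  ext_vanishes : ∀ X Y, C X → C Y → ExtOneVanishes X Y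
  injDim_le_one : ∀ X, C X → InjDimLEOne X
  resolution : ∀ I : A, Injective I →
    ∃ (C₁ C₀ : A) (i : C₁ ⟶ C₀) (p : C₀ ⟶ I), C C₁ ∧ C C₀ ∧ IsSES i p
  covariantlyFinite : CovariantlyFinite C

/-- `(T, F)` is a torsion pair. -/
structure IsTorsionPair (T F : ObjectProperty A) : Prop where
  hom_eq_zero : ∀ (X Y : A) (f : X ⟶ Y), T X → F Y → f = 0
  exists_ses : ∀ X : A, ∃ (tX fX : A) (i : tX ⟶ X) (p : X ⟶ fX), T tX ∧ F fX ∧ IsSES i p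

/-- `(C, D)` is a (complete) cotorsion pair. -/
structure IsCotorsionPair (C D : ObjectProperty A) : Prop where
  left_eq : C = leftExtOrthogonal D
  right_eq : D = rightExtOrthogonal C
  exists_ses_left : ∀ X : A, ∃ (dX cX : A) (i : dX ⟶ cX) (p : cX ⟶ X), D dX ∧ C cX ∧ IsSES i p
  exists_ses_right : ∀ X : A, ∃ (dX cX : A) (i : X ⟶ dX) (p : dX ⟶ cX), D dX ∧ C cX ∧ IsSES i p

end Abelian

/-! ### Additive quotients -/

/-- Two parallel morphisms are related if their difference factors through an object of `X`. -/
def factorRel {E : Type u} [Category.{v} E] [Preadditive E] (X : ObjectProperty E) : HomRel E :=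
  fun {E₁ E₂} f g => ∃ (Z : E) (a : E₁ ⟶ Z) (b : Z ⟶ E₂), X Z ∧ a ≫ b = f - g

section Functors

variable {A : Type u} [Category.{v} A] [Abelian A]

/-- The additive quotient `S / X` of the full subcategory `S` of `A` by its objects in `X`. -/
abbrev AddQuotient (S X : ObjectProperty A) : Type u :=
  Quotient (factorRel (X.inverseImage S.ι))

/-- The canonical functor `S ⥤ S / X`. -/
abbrev toAddQuotient (S X : ObjectProperty A) : S.FullSubcategory ⥤ AddQuotient S X :=
  Quotient.functor (factorRel (X.inverseImage S.ι))

/-- `f : A ⥤ F` is the torsion-free part functor of the torsion pair `(T, F)`: there are short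
exact sequences `tM ⟶ M ⟶ fM` with `tM` in `T`, natural in `M`. -/
def IsTorsionFreePart (T F : ObjectProperty A) (f : A ⥤ F.FullSubcategory) : Prop :=
  ∃ η : 𝟭 A ⟶ f ⋙ F.ι, ∀ M : A, ∃ (tM : A) (i : tM ⟶ M), T tM ∧ IsSES i (η.app M)

/-- `t : A ⥤ T` is the torsion part functor of the torsion pair `(T, F)`: there are short
exact sequences `tM ⟶ M ⟶ fM` with `fM` in `F`, natural in `M`. -/
def IsTorsionPart (T F : ObjectProperty A) (t : A ⥤ T.FullSubcategory) : Prop :=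
  ∃ ε : t ⋙ T.ι ⟶ 𝟭 A, ∀ M : A, ∃ (fM : A) (p : M ⟶ fM), F fM ∧ IsSES (ε.app M) p

/-- `c : A ⥤ C / X` is the functor given by choosing short exact sequences `dM ⟶ cM ⟶ M` with
`cM` in `C` and `dM` in `D`, and sending `g : M ⟶ N` to the class of a lift `cM ⟶ cN` of `g`.
It is used when `(C, D)` is a cotorsion pair and `X` is the intersection of `C` and `D`. -/
def IsCotorsionPart (C D X : ObjectProperty A) (c : A ⥤ AddQuotient C X) : Prop :=
  ∃ (cObj : A → C.FullSubcategory) (p : ∀ M, C.ι.obj (cObj M) ⟶ M)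
    (θ : ∀ M, c.obj M ≅ (toAddQuotient C X).obj (cObj M)),
    (∀ M, ∃ (dM : A) (i : dM ⟶ C.ι.obj (cObj M)), D dM ∧ IsSES i (p M)) ∧
    ∀ (M N : A) (g : M ⟶ N), ∃ l : cObj M ⟶ cObj N,
      C.ι.map l ≫ p N = p M ≫ g ∧
      c.map g ≫ (θ N).hom = (θ M).hom ≫ (toAddQuotient C X).map l

/-- `d : A ⥤ D / X` is the functor given by choosing short exact sequences `M ⟶ dM ⟶ cM` with
`dM` in `D` and `cM` in `C`, and sending `g : M ⟶ N` to the class of an extension `dM ⟶ dN`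
of `g`. It is used when `(C, D)` is a cotorsion pair and `X` is the intersection of `C` and `D`. -/
def IsCotorsionFreePart (C D X : ObjectProperty A) (d : A ⥤ AddQuotient D X) : Prop :=
  ∃ (dObj : A → D.FullSubcategory) (i : ∀ M, M ⟶ D.ι.obj (dObj M))
    (θ : ∀ M, d.obj M ≅ (toAddQuotient D X).obj (dObj M)),
    (∀ M, ∃ (cM : A) (p : D.ι.obj (dObj M) ⟶ cM), C cM ∧ IsSES (i M) p) ∧
    ∀ (M N : A) (g : M ⟶ N), ∃ l : dObj M ⟶ dObj N,
      i M ≫ D.ι.map l = g ≫ i N ∧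
      d.map g ≫ (θ N).hom = (θ M).hom ≫ (toAddQuotient D X).map l

end Functors

/-! ### Representations of finite acyclic quivers -/


/-- A quiver is acyclic if the only oriented cycles are the trivial paths. -/
class IsAcyclicQuiver (Q : Type w) [Quiver.{w'} Q] : Prop where
  length_eq_zero : ∀ (i : Q) (p : Quiver.Path i i), p.length = 0

/-- A finite acyclic quiver has only finitely many paths. -/
theorem finite_path (Q : Type w) [Quiver.{w'} Q] [Finite Q] [∀ i j : Q, Finite (i ⟶ j)]
    [IsAcyclicQuiver Q] (i j : Q) : Finite (Quiver.Path i j) := by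
  let r : Q → Q → Prop := fun k l => ∃ p : Quiver.Path k l, 0 < p.length
  have : IsTrans Q r := ⟨by
    rintro a b c ⟨p, hp⟩ ⟨q, hq⟩
    exact ⟨p.comp q, by rw [Quiver.Path.length_comp]; omega⟩⟩
  have : Std.Irrefl r := ⟨by
    rintro a ⟨p, hp⟩
    have := IsAcyclicQuiver.length_eq_zero a p
    omega⟩
  have wf : WellFounded r := Finite.wellFounded_of_trans_of_irrefl r
  induction j using wf.induction with
  | _ j ih =>
    have : ∀ k : Q, Finite (Quiver.Path i k × (k ⟶ j)) := fun k => by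
      rcases isEmpty_or_nonempty (k ⟶ j) with h | ⟨⟨e⟩⟩
      · infer_instance
      · have := ih k ⟨e.toPath, by simp⟩
        infer_instance
    let F : PLift (i = j) ⊕ (Σ k : Q, Quiver.Path i k × (k ⟶ j)) → Quiver.Path i j :=
      fun s => match s with
        | Sum.inl h => h.down ▸ Quiver.Path.nil
        | Sum.inr ⟨_, p, e⟩ => p.cons e
    refine Finite.of_surjective F ?_
    intro p
    cases p with
    | nil => exact ⟨Sum.inl ⟨rfl⟩, rfl⟩
    | cons p e => exact ⟨Sum.inr ⟨_, p, e⟩, rfl⟩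

section Quiver

variable (Q : Type w) [Quiver.{w'} Q] [Finite Q] [∀ i j : Q, Finite (i ⟶ j)] [IsAcyclicQuiver Q]
variable (A : Type u) [Category.{v} A] [Abelian A]

instance (i j : Paths Q) : Finite (i ⟶ j) := finite_path Q i j

/-- `[Q, A]`: representations of `Q` in `A`, i.e. functors from the free category on `Q`. -/
abbrev QRep (Q : Type w) [Quiver.{w'} Q] (A : Type u) [Category.{v} A] :=
  Paths Q ⥤ A

variable {Q}

/-- The left adjoint `P_i` of evaluation at `i`: `P_i(M)_j` is the (finite) direct sum of copies
of `M` indexed by the paths from `i` to `j`. -/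
abbrev PFunctor (i : Q) : A ⥤ QRep Q A :=
  evaluationLeftAdjoint A ((Paths.of Q).obj i)

/-- The right adjoint `I_i` of evaluation at `i`: `I_i(M)_j` is the (finite) product, i.e. the
direct sum, of copies of `M` indexed by the paths from `j` to `i`. -/
abbrev IFunctor (i : Q) : A ⥤ QRep Q A :=
  evaluationRightAdjoint A ((Paths.of Q).obj i)

variable (Q)

/-- `𝕋 = add {I_i(P) | i a vertex, P projective in A}`. -/
def tiltingT : ObjectProperty (QRep Q A) :=
  addClosure fun X => ∃ (i : Q) (P : A), Projective P ∧ X = (IFunctor A i).obj P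

/-- `ℂ = add {P_i(I) | i a vertex, I injective in A}`. -/
def cotiltingC : ObjectProperty (QRep Q A) :=
  addClosure fun X => ∃ (i : Q) (I : A), Injective I ∧ X = (PFunctor A i).obj I

/-- `[Q, Proj A]`: the representations that are projective at every vertex. -/
def repProj (Q : Type w) [Quiver.{w'} Q] (A : Type u) [Category.{v} A] :
    ObjectProperty (QRep Q A) :=
  fun X => ∀ i : Q, Projective (X.obj ((Paths.of Q).obj i))

/-- `[Q, Inj A]`: the representations that are injective at every vertex. -/
def repInj (Q : Type w) [Quiver.{w'} Q] (A : Type u) [Category.{v} A] :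
    ObjectProperty (QRep Q A) :=
  fun X => ∀ i : Q, Injective (X.obj ((Paths.of Q).obj i))

end Quiver

end

end QuiverTilting

open QuiverTilting

/-!
The tilting theorem and the cotilting theorem both follow formally from a few properties of a pair
of subcategories of an abelian category. For the tilting theorem they are collected in
`IsTiltingFrame C T`, to be applied to `C = [Q, Proj A]` and `T = 𝕋`: `C` contains `T` and the
projective objects and is closed under extensions and summands, its objects have projective
dimension at most one, `Ext¹(C, T) = 0`, every object of `C` embeds into an object of `T` with
cokernel in `C`, and `T` is contravariantly finite.

Since objects of `C` have projective dimension at most one, `Ext¹(C, Fac T) = 0`. If `X` lies in `C`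
and `X ⟶ T₀ ⟶ Z` is the given embedding, then `Ext¹(Z, Y) = 0` for `Y` in `Fac T`, so every morphism
from `X` to `Y` factors through `T₀`. For `Y = X` this shows that `C ∩ Fac T = T`, whence `Z` is in
`T`. Pushing out the resulting coresolutions of projective objects gives the approximation
sequences of the cotorsion pair, and the image of a right `T`-approximation is the torsion
subobject. The functor `C / T ⥤ T^⊥` induced by the torsion-free part is full and essentially
surjective because the kernels of `M ⟶ fM` and `cM ⟶ M` lie in `Fac T`, to which `Ext¹` from `C`
vanishes; it is faithful because morphisms from `C` to `Fac T` factor through `T`.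

For representations (`isTiltingFrame_repProj`) two properties need an argument.

* Projective dimension at most one (`repProj.exists_ext_lifting`). An extension of `X` in
  `[Q, Proj A]` splits at every vertex, so it is given by an arbitrary family of morphisms indexed
  by the arrows of `Q`, since the path category is free. Such families lift along epimorphisms,
  which means that `Ext²(X, -) = 0`.
* Contravariant finiteness (`exists_coinduced_approximation`). A morphism from `I_i(M)` to `X` is a
  family of morphisms from `M` subject to finitely many linear relations, so the functor
  `Hom(I_i(-), X)` is represented by a kernel in `A`. Covering this kernel by a projective object
  gives an approximation.

The vanishing of `Ext¹([Q, Proj A], 𝕋)` comes from the adjunction between evaluation and `I_i`.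
The cotilting theorem is dual, with `IsCotiltingFrame` in place of `IsTiltingFrame`.
-/

noncomputable section

namespace QuiverTilting

attribute [local instance] Abelian.hasFiniteBiproducts

/-! ### Short exact sequences -/

section ShortExactSequences

variable {E : Type u} [Category.{v} E] [Abelian E]

namespace IsSES

variable {X Y Z : E} {i : X ⟶ Y} {p : Y ⟶ Z}

lemma zero (h : IsSES i p) : i ≫ p = 0 := h.choose

lemma mono (h : IsSES i p) : Mono i := h.choose_spec.mono_f

lemma epi (h : IsSES i p) : Epi p := h.choose_spec.epi_g

lemma exists_lift (h : IsSES i p) {W : E} (f : W ⟶ Y) (hf : f ≫ p = 0) :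
    ∃ g : W ⟶ X, g ≫ i = f := by
  obtain ⟨w, hS⟩ := h
  have := hS.mono_f
  exact ⟨hS.exact.lift f hf, hS.exact.lift_f f hf⟩

lemma exists_desc (h : IsSES i p) {W : E} (f : Y ⟶ W) (hf : i ≫ f = 0) :
    ∃ g : Z ⟶ W, p ≫ g = f := by
  obtain ⟨w, hS⟩ := h
  have := hS.epi_g
  exact ⟨hS.exact.desc f hf, hS.exact.g_desc f hf⟩

lemma of_exists_desc (w : i ≫ p = 0) [Mono i] [Epi p]
    (H : ∀ (W : E) (f : Y ⟶ W), i ≫ f = 0 → ∃ g : Z ⟶ W, p ≫ g = f) : IsSES i p := by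
  refine ⟨w, ⟨ShortComplex.exact_of_g_is_cokernel _ ?_⟩⟩
  choose g hg using H
  exact CokernelCofork.IsColimit.ofπ' p w fun {A} k hk => ⟨g A k hk, hg A k hk⟩

lemma of_exists_lift (w : i ≫ p = 0) [Mono i] [Epi p]
    (H : ∀ (W : E) (f : W ⟶ Y), f ≫ p = 0 → ∃ g : W ⟶ X, g ≫ i = f) : IsSES i p := by
  refine ⟨w, ⟨ShortComplex.exact_of_f_is_kernel _ ?_⟩⟩
  choose g hg using H
  exact KernelFork.IsLimit.ofι' i w fun {A} k hk => ⟨g A k hk, hg A k hk⟩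

lemma of_epi (p : Y ⟶ Z) [Epi p] : IsSES (kernel.ι p) p :=
  of_exists_lift (kernel.condition p) fun _ f hf => ⟨kernel.lift p f hf, kernel.lift_ι p f hf⟩

lemma of_mono (i : X ⟶ Y) [Mono i] : IsSES i (cokernel.π i) :=
  of_exists_desc (cokernel.condition i) fun _ f hf =>
    ⟨cokernel.desc i f hf, cokernel.π_desc i f hf⟩

/-- The pushout of a short exact sequence along a morphism out of its left term; the cokernel of
that morphism is also the cokernel of the induced morphism between the middle terms. -/
lemma exists_pushout (h : IsSES i p) {X' : E} (f : X ⟶ X') :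
    ∃ (Y' : E) (j : X' ⟶ Y') (q : Y' ⟶ Z) (g : Y ⟶ Y'), IsSES j q ∧ g ≫ q = p ∧ i ≫ g = f ≫ j ∧
      (Epi f → Epi g) ∧
      ∀ (L : E) (k : X' ⟶ L), IsSES f k → ∃ l : Y' ⟶ L, IsSES g l := by
  have := h.mono
  obtain ⟨q, hq, hq'⟩ := pushout.desc' (f := i) (g := f) p 0 (by rw [h.zero, comp_zero])
  have : Epi q := by
    have : Epi (pushout.inl i f ≫ q) := by rw [hq]; exact h.epi
    exact epi_of_epi (pushout.inl i f) q
  refine ⟨pushout i f, pushout.inr i f, q, pushout.inl i f, ?_, hq, pushout.condition,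
    fun _ => inferInstance, ?_⟩
  · refine of_exists_desc hq' fun W a ha => ?_
    obtain ⟨g, hg⟩ := h.exists_desc (pushout.inl i f ≫ a) (by
      rw [pushout.condition_assoc, ha, comp_zero])
    exact ⟨g, pushout.hom_ext (by rw [reassoc_of% hq, hg])
      (by rw [reassoc_of% hq', ha, zero_comp])⟩
  · intro L k hk
    have := hk.mono
    have := hk.epi
    obtain ⟨l, hl', hl⟩ := pushout.desc' (f := i) (g := f) 0 k (by rw [hk.zero, comp_zero])
    have : Epi l := by
      have : Epi (pushout.inr i f ≫ l) := by rwa [hl]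
      exact epi_of_epi (pushout.inr i f) l
    refine ⟨l, of_exists_desc hl' fun W a ha => ?_⟩
    obtain ⟨g, hg⟩ := hk.exists_desc (pushout.inr i f ≫ a) (by
      rw [← pushout.condition_assoc, ha, comp_zero])
    exact ⟨g, pushout.hom_ext (by rw [reassoc_of% hl', ha, zero_comp])
      (by rw [reassoc_of% hl, hg])⟩

/-- The pullback of a short exact sequence along a morphism into its right term; the kernel of
that morphism is also the kernel of the induced morphism between the middle terms. -/
lemma exists_pullback (h : IsSES i p) {Z' : E} (f : Z' ⟶ Z) :
    ∃ (Y' : E) (j : X ⟶ Y') (q : Y' ⟶ Z') (g : Y' ⟶ Y), IsSES j q ∧ j ≫ g = i ∧ g ≫ p = q ≫ f ∧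
      (Mono f → Mono g) ∧
      ∀ (L : E) (k : L ⟶ Z'), IsSES k f → ∃ l : L ⟶ Y', IsSES l g := by
  have := h.mono
  have := h.epi
  obtain ⟨j, hj, hj'⟩ := pullback.lift' (f := p) (g := f) i 0 (by rw [h.zero, zero_comp])
  have : Mono j := by
    have : Mono (j ≫ pullback.fst p f) := by rwa [hj]
    exact mono_of_mono j (pullback.fst p f)
  refine ⟨pullback p f, j, pullback.snd p f, pullback.fst p f, ?_, hj, pullback.condition,
    fun _ => inferInstance, ?_⟩
  · refine of_exists_lift hj' fun W a ha => ?_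
    obtain ⟨g, hg⟩ := h.exists_lift (a ≫ pullback.fst p f) (by
      rw [Category.assoc, pullback.condition, reassoc_of% ha, zero_comp])
    exact ⟨g, pullback.hom_ext (by rw [Category.assoc, hj, hg])
      (by rw [Category.assoc, hj', ha, comp_zero])⟩
  · intro L k hk
    have := hk.mono
    have := hk.epi
    obtain ⟨l, hl', hl⟩ := pullback.lift' (f := p) (g := f) 0 k (by rw [hk.zero, zero_comp])
    have : Mono l := by
      have : Mono (l ≫ pullback.snd p f) := by rwa [hl]
      exact mono_of_mono l (pullback.snd p f)
    refine ⟨l, of_exists_lift hl' fun W a ha => ?_⟩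
    obtain ⟨g, hg⟩ := hk.exists_lift (a ≫ pullback.snd p f) (by
      rw [Category.assoc, ← pullback.condition, reassoc_of% ha, zero_comp])
    exact ⟨g, pullback.hom_ext (by rw [Category.assoc, hl', ha, comp_zero])
      (by rw [Category.assoc, hl, hg])⟩

/-- A retraction of the left map of a short exact sequence yields a section of the right map. -/
lemma exists_section (h : IsSES i p) {r : Y ⟶ X} (hr : i ≫ r = 𝟙 X) :
    ∃ s : Z ⟶ Y, s ≫ p = 𝟙 Z ∧ r ≫ i + p ≫ s = 𝟙 Y := by
  have := h.epi
  obtain ⟨s, hs⟩ := h.exists_desc (𝟙 Y - r ≫ i) (by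
    rw [Preadditive.comp_sub, reassoc_of% hr]; simp)
  refine ⟨s, ?_, by rw [hs]; abel⟩
  rw [← cancel_epi p, reassoc_of% hs, Preadditive.sub_comp, Category.assoc, h.zero]
  simp

/-- A section of the right map of a short exact sequence yields a retraction of the left map. -/
lemma exists_retraction (h : IsSES i p) {s : Z ⟶ Y} (hs : s ≫ p = 𝟙 Z) :
    ∃ r : Y ⟶ X, i ≫ r = 𝟙 X ∧ r ≫ i + p ≫ s = 𝟙 Y := by
  have := h.mono
  obtain ⟨r, hr⟩ := h.exists_lift (𝟙 Y - p ≫ s) (by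
    rw [Preadditive.sub_comp, Category.assoc, hs]; simp)
  refine ⟨r, ?_, by rw [hr]; abel⟩
  rw [← cancel_mono i, Category.assoc, hr, Preadditive.comp_sub, reassoc_of% h.zero]
  simp

end IsSES

end ShortExactSequences

/-! ### Vanishing of `Ext¹` -/

section ExtOne

variable {E : Type u} [Category.{v} E] [Abelian E]

namespace ExtOneVanishes

variable {X Y : E}

lemma exists_extension (h : ExtOneVanishes X Y) {K M : E} {i : K ⟶ M} {p : M ⟶ X}
    (hS : IsSES i p) (f : K ⟶ Y) : ∃ g : M ⟶ Y, i ≫ g = f := by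
  let := HasExt.standard E
  obtain ⟨w, hS⟩ := hS
  have h' : Subsingleton (Abelian.Ext.{max u v} X Y 1) := h
  obtain ⟨x, hx⟩ := Abelian.Ext.contravariant_sequence_exact₁ hS Y
    (Abelian.Ext.mk₀ f) (add_zero 1) (h'.elim _ _)
  obtain ⟨g, rfl⟩ := Abelian.Ext.mk₀_bijective _ _ |>.2 x
  exact ⟨g, (Abelian.Ext.mk₀_bijective _ _).1 (by simpa using hx)⟩

lemma exists_lifting (h : ExtOneVanishes X Y) {M L : E} {i : Y ⟶ M} {p : M ⟶ L}
    (hS : IsSES i p) (f : X ⟶ L) : ∃ g : X ⟶ M, g ≫ p = f := by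
  let := HasExt.standard E
  obtain ⟨w, hS⟩ := hS
  have h' : Subsingleton (Abelian.Ext.{max u v} X Y 1) := h
  obtain ⟨x, hx⟩ := Abelian.Ext.covariant_sequence_exact₃ X hS
    (Abelian.Ext.mk₀ f) (zero_add 1) (h'.elim _ _)
  obtain ⟨g, rfl⟩ := Abelian.Ext.mk₀_bijective _ _ |>.2 x
  exact ⟨g, (Abelian.Ext.mk₀_bijective _ _).1 (by simpa using hx)⟩

lemma of_projective {K P : E} {i : K ⟶ P} {p : P ⟶ X} [Projective P] (hS : IsSES i p)
    (H : ∀ f : K ⟶ Y, ∃ g : P ⟶ Y, i ≫ g = f) : ExtOneVanishes X Y := by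
  let := HasExt.standard E
  obtain ⟨w, hS⟩ := hS
  refine subsingleton_of_forall_eq 0 fun x => ?_
  obtain ⟨y, rfl⟩ := Abelian.Ext.contravariant_sequence_exact₃ hS Y x
    (Abelian.Ext.eq_zero_of_projective _) (add_zero 1)
  obtain ⟨f, rfl⟩ := Abelian.Ext.mk₀_bijective _ _ |>.2 y
  obtain ⟨g, rfl⟩ := H f
  rw [← Abelian.Ext.mk₀_comp_mk₀]
  exact hS.extClass_comp_assoc _

lemma of_injective {J L : E} {i : Y ⟶ J} {p : J ⟶ L} [Injective J] (hS : IsSES i p)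
    (H : ∀ f : X ⟶ L, ∃ g : X ⟶ J, g ≫ p = f) : ExtOneVanishes X Y := by
  let := HasExt.standard E
  obtain ⟨w, hS⟩ := hS
  refine subsingleton_of_forall_eq 0 fun x => ?_
  obtain ⟨y, rfl⟩ := Abelian.Ext.covariant_sequence_exact₁ X hS x
    (Abelian.Ext.eq_zero_of_injective _) (zero_add 1)
  obtain ⟨f, rfl⟩ := Abelian.Ext.mk₀_bijective _ _ |>.2 y
  obtain ⟨g, rfl⟩ := H f
  rw [← Abelian.Ext.mk₀_comp_mk₀, Abelian.Ext.comp_assoc_of_second_deg_zero]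
  erw [hS.comp_extClass]
  simp

end ExtOneVanishes

/-- If `Y` has projective dimension at most one, then the vanishing of `Ext¹(Y, -)` passes to
quotients, because `Ext²(Y, -) = 0`. -/
lemma ProjDimLEOne.extOneVanishes_of_epi {Y M N : E} (hY : ProjDimLEOne Y)
    (h : ExtOneVanishes Y M) (p : M ⟶ N) [Epi p] : ExtOneVanishes Y N := by
  obtain ⟨P₁, P₀, i, q, _, _, hS⟩ := hY
  refine ExtOneVanishes.of_projective hS fun f => ?_
  obtain ⟨g, hg⟩ := h.exists_extension hS (Projective.factorThru f p)
  exact ⟨g ≫ p, by rw [reassoc_of% hg, Projective.factorThru_comp]⟩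

/-- If `Y` has injective dimension at most one, then the vanishing of `Ext¹(-, Y)` passes to
subobjects, because `Ext²(-, Y) = 0`. -/
lemma InjDimLEOne.extOneVanishes_of_mono {Y M N : E} (hY : InjDimLEOne Y)
    (h : ExtOneVanishes M Y) (i : N ⟶ M) [Mono i] : ExtOneVanishes N Y := by
  obtain ⟨J₀, J₁, j, q, _, _, hS⟩ := hY
  refine ExtOneVanishes.of_injective hS fun f => ?_
  obtain ⟨g, hg⟩ := h.exists_lifting hS (Injective.factorThru f i)
  exact ⟨i ≫ g, by rw [Category.assoc, hg, Injective.comp_factorThru]⟩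

end ExtOne

/-! ### Finite direct sums and summands -/

section AddClosure

variable {E : Type u} [Category.{v} E] [Abelian E] {S : ObjectProperty E}

lemma isFiniteSumOf_biproduct {ι : Type*} [Finite ι] (f : ι → E) (hf : ∀ k, S (f k)) :
    IsFiniteSumOf S (⨁ f) := by
  obtain ⟨n, ⟨e⟩⟩ := Finite.exists_equiv_fin ι
  exact ⟨n, f ∘ e.symm, fun k => hf _,
    ⟨biproduct.whiskerEquiv e fun j => eqToIso (by simp)⟩⟩

lemma isFiniteSumOf_self {X : E} (hX : S X) : IsFiniteSumOf S X :=
  ⟨1, fun _ => X, fun _ => hX, ⟨(biproductUniqueIso fun _ : Fin 1 => X).symm⟩⟩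

lemma IsFiniteSumOf.addClosure {X : E} (hX : IsFiniteSumOf S X) : addClosure S X :=
  ⟨X, hX, ⟨Retract.refl X⟩⟩

lemma le_addClosure : S ≤ addClosure S := fun _ hX => (isFiniteSumOf_self hX).addClosure

lemma addClosure_of_retract {X Y : E} (r : Retract X Y) (hY : addClosure S Y) :
    addClosure S X := by
  obtain ⟨Z, hZ, ⟨s⟩⟩ := hY
  exact ⟨Z, hZ, ⟨r.trans s⟩⟩

lemma addClosure_biproduct {n : ℕ} (f : Fin n → E) (hf : ∀ k, addClosure S (f k)) :
    addClosure S (⨁ f) := by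
  choose Y hY r using hf
  choose m g hg e using hY
  refine ⟨⨁ fun x : Σ k, Fin (m k) => g x.1 x.2, isFiniteSumOf_biproduct _ fun x => hg _ _, ⟨?_⟩⟩
  let s : Retract (⨁ f) (⨁ fun k => ⨁ g k) :=
    { i := biproduct.map fun k => (r k).some.i ≫ (e k).some.hom
      r := biproduct.map fun k => (e k).some.inv ≫ (r k).some.r
      retract := by ext; simp }
  exact s.trans (Retract.ofIso (biproductBiproductIso _ g))

/-- `add S` is closed under finite direct sums and direct summands. -/
lemma addClosure_addClosure {X : E} (hX : addClosure (addClosure S) X) : addClosure S X := by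
  obtain ⟨Y, ⟨n, f, hf, ⟨e⟩⟩, ⟨r⟩⟩ := hX
  exact addClosure_of_retract (r.trans (Retract.ofIso e)) (addClosure_biproduct f hf)

/-- If every morphism from `K` to an object of `S` extends along `i`, then so does every morphism
to an object of `add S`. -/
lemma exists_extension_of_addClosure {K M : E} (i : K ⟶ M)
    (H : ∀ (Y : E) (f : K ⟶ Y), S Y → ∃ g : M ⟶ Y, i ≫ g = f) (Y : E) (f : K ⟶ Y)
    (hY : addClosure S Y) : ∃ g : M ⟶ Y, i ≫ g = f := by
  obtain ⟨Z, ⟨n, F, hF, ⟨e⟩⟩, ⟨r⟩⟩ := hY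
  choose g hg using fun k => H (F k) (f ≫ r.i ≫ e.hom ≫ biproduct.π F k) (hF k)
  refine ⟨biproduct.lift g ≫ e.inv ≫ r.r, ?_⟩
  have : i ≫ biproduct.lift g = f ≫ r.i ≫ e.hom := by ext k; simp [hg]
  rw [reassoc_of% this]
  simp

/-- If every morphism from an object of `S` to `L` lifts along `p`, then so does every morphism
from an object of `add S`. -/
lemma exists_lifting_of_addClosure {M L : E} (p : M ⟶ L)
    (H : ∀ (X : E) (f : X ⟶ L), S X → ∃ g : X ⟶ M, g ≫ p = f) (X : E) (f : X ⟶ L)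
    (hX : addClosure S X) : ∃ g : X ⟶ M, g ≫ p = f := by
  obtain ⟨Z, ⟨n, F, hF, ⟨e⟩⟩, ⟨r⟩⟩ := hX
  choose g hg using fun k => H (F k) (biproduct.ι F k ≫ e.inv ≫ r.r ≫ f) (hF k)
  refine ⟨r.i ≫ e.hom ≫ biproduct.desc g, ?_⟩
  have : biproduct.desc g ≫ p = e.inv ≫ r.r ≫ f := by ext k; simp [hg]
  simp [this]

lemma facCat_iff (hS : ∀ X, addClosure S X → S X) {X : E} :
    FacCat S X ↔ ∃ (Y : E) (p : Y ⟶ X), S Y ∧ Epi p :=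
  ⟨fun ⟨Y, hY, p, hp⟩ => ⟨Y, p, hS Y hY.addClosure, hp⟩,
    fun ⟨Y, p, hY, hp⟩ => ⟨Y, isFiniteSumOf_self hY, p, hp⟩⟩

lemma subCat_iff (hS : ∀ X, addClosure S X → S X) {X : E} :
    SubCat S X ↔ ∃ (Y : E) (i : X ⟶ Y), S Y ∧ Mono i :=
  ⟨fun ⟨Y, hY, i, hi⟩ => ⟨Y, i, hS Y hY.addClosure, hi⟩,
    fun ⟨Y, i, hY, hi⟩ => ⟨Y, isFiniteSumOf_self hY, i, hi⟩⟩

end AddClosure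

/-! ### Torsion pairs and additive quotients -/

section TorsionPairs

variable {E : Type u} [Category.{v} E] [Abelian E]

/-- The torsion-free quotient of an object is unique up to isomorphism. -/
lemma exists_iso_of_torsion_ses {T F : ObjectProperty E}
    (hTF : ∀ (X Y : E) (f : X ⟶ Y), T X → F Y → f = 0) {X t t' Y Y' : E}
    {i : t ⟶ X} {p : X ⟶ Y} {i' : t' ⟶ X} {p' : X ⟶ Y'} (h : IsSES i p) (h' : IsSES i' p')
    (ht : T t) (ht' : T t') (hY : F Y) (hY' : F Y') : ∃ e : Y ≅ Y', p ≫ e.hom = p' := by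
  have := h.epi
  have := h'.epi
  obtain ⟨a, ha⟩ := h.exists_desc p' (hTF _ _ _ ht hY')
  obtain ⟨b, hb⟩ := h'.exists_desc p (hTF _ _ _ ht' hY)
  exact ⟨⟨a, b, by rw [← cancel_epi p, reassoc_of% ha, hb, Category.comp_id],
    by rw [← cancel_epi p', reassoc_of% hb, ha, Category.comp_id]⟩, ha⟩

/-- The torsion subobject of an object is unique up to isomorphism. -/
lemma exists_iso_of_torsionFree_ses {T F : ObjectProperty E}
    (hTF : ∀ (X Y : E) (f : X ⟶ Y), T X → F Y → f = 0) {X Y Y' f f' : E}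
    {i : Y ⟶ X} {p : X ⟶ f} {i' : Y' ⟶ X} {p' : X ⟶ f'} (h : IsSES i p) (h' : IsSES i' p')
    (hf : F f) (hf' : F f') (hY : T Y) (hY' : T Y') : ∃ e : Y ≅ Y', e.hom ≫ i' = i := by
  have := h.mono
  have := h'.mono
  obtain ⟨a, ha⟩ := h'.exists_lift i (hTF _ _ _ hY hf')
  obtain ⟨b, hb⟩ := h.exists_lift i' (hTF _ _ _ hY' hf)
  exact ⟨⟨a, b, by rw [← cancel_mono i, Category.assoc, hb, ha, Category.id_comp],
    by rw [← cancel_mono i', Category.assoc, ha, hb, Category.id_comp]⟩, ha⟩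

lemma IsTorsionPair.exists_torsionFreePart {T F : ObjectProperty E} (h : IsTorsionPair T F) :
    ∃ f, IsTorsionFreePart T F f := by
  choose t f i p ht hf hS using h.exists_ses
  have hp : ∀ M, Epi (p M) := fun M => (hS M).epi
  have hmap : ∀ {M N : E} (g : M ⟶ N), ∃ k : f M ⟶ f N, p M ≫ k = g ≫ p N := fun {M N} g =>
    (hS M).exists_desc _ (h.hom_eq_zero _ _ _ (ht M) (hf N))
  choose k hk using @hmap
  refine ⟨{ obj := fun M => ⟨f M, hf M⟩
            map := fun g => ObjectProperty.homMk (k g)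
            map_id := fun M => ?_
            map_comp := fun {M N K} g g' => ?_ },
    { app := p, naturality := fun M N g => (hk g).symm }, fun M => ⟨t M, i M, ht M, hS M⟩⟩
  · ext
    change k (𝟙 M) = 𝟙 (f M)
    rw [← cancel_epi (p M), hk, Category.id_comp, Category.comp_id]
  · ext
    change k (g ≫ g') = k g ≫ k g'
    rw [← cancel_epi (p M), hk, reassoc_of% hk g, hk, Category.assoc]

lemma IsTorsionPair.exists_torsionPart {T F : ObjectProperty E} (h : IsTorsionPair T F) :
    ∃ t, IsTorsionPart T F t := by
  choose t f i p ht hf hS using h.exists_ses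
  have hi : ∀ M, Mono (i M) := fun M => (hS M).mono
  have hmap : ∀ {M N : E} (g : M ⟶ N), ∃ k : t M ⟶ t N, k ≫ i N = i M ≫ g := fun {M N} g =>
    (hS N).exists_lift _ (h.hom_eq_zero _ _ _ (ht M) (hf N))
  choose k hk using @hmap
  refine ⟨{ obj := fun M => ⟨t M, ht M⟩
            map := fun g => ObjectProperty.homMk (k g)
            map_id := fun M => ?_
            map_comp := fun {M N K} g g' => ?_ },
    { app := i, naturality := fun M N g => hk g }, fun M => ⟨f M, p M, hf M, hS M⟩⟩
  · ext
    change k (𝟙 M) = 𝟙 (t M)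
    rw [← cancel_mono (i M), hk, Category.id_comp, Category.comp_id]
  · ext
    change k (g ≫ g') = k g ≫ k g'
    rw [← cancel_mono (i K), hk, Category.assoc, hk, reassoc_of% hk g]

/-- Morphisms of `S` whose difference factors in the ambient category through an object of `X`
become equal in `S / X`. -/
lemma toAddQuotient_map_eq {S X : ObjectProperty E} (hXS : X ≤ S) {M N : S.FullSubcategory}
    {f g : M ⟶ N} {Z : E} (hZ : X Z) (a : M.obj ⟶ Z) (b : Z ⟶ N.obj)
    (hab : a ≫ b = f.hom - g.hom) :
    (toAddQuotient S X).map f = (toAddQuotient S X).map g :=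
  CategoryTheory.Quotient.sound _
    ⟨⟨Z, hXS _ hZ⟩, ObjectProperty.homMk a, ObjectProperty.homMk b, hZ,
      ObjectProperty.hom_ext _ hab⟩

end TorsionPairs

/-! ### The tilting theorem in an abelian category -/

section Tilting

variable {E : Type u} [Category.{v} E] [Abelian E]

lemma facCat_of_epi {T : ObjectProperty E} {X Y : E} (p : X ⟶ Y) [Epi p] (hX : FacCat T X) :
    FacCat T Y := by
  obtain ⟨Z, hZ, q, hq⟩ := hX
  exact ⟨Z, hZ, q ≫ p, inferInstance⟩

/-- The properties of `C = [Q, Proj A]` and `T = add {I_i(P)}` from which the tilting theorem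
follows formally. -/
structure IsTiltingFrame (C T : ObjectProperty E) : Prop where
  le : T ≤ C
  add_closed : ∀ X, addClosure T X → T X
  of_retract : ∀ {X Y : E}, Retract X Y → C Y → C X
  of_isSES : ∀ {X Y Z : E} {i : X ⟶ Y} {p : Y ⟶ Z}, IsSES i p → C X → C Z → C Y
  of_projective : ∀ P : E, Projective P → C P
  projDim_le_one : ∀ X, C X → ProjDimLEOne X
  ext_vanishes : ∀ X Y, C X → T Y → ExtOneVanishes X Y
  exists_embedding : ∀ X, C X → ∃ (T₀ Z : E) (i : X ⟶ T₀) (p : T₀ ⟶ Z), T T₀ ∧ C Z ∧ IsSES i p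
  contravariantlyFinite : ContravariantlyFinite T

namespace IsTiltingFrame

variable {C T : ObjectProperty E} (h : IsTiltingFrame C T)
include h

lemma le_facCat : T ≤ FacCat T :=
  fun X hX => (facCat_iff h.add_closed).2 ⟨X, 𝟙 X, hX, inferInstance⟩

lemma extOneVanishes_of_facCat {X Y : E} (hX : C X) (hY : FacCat T Y) :
    ExtOneVanishes X Y := by
  obtain ⟨Z, p, hZ, _⟩ := (facCat_iff h.add_closed).1 hY
  exact (h.projDim_le_one X hX).extOneVanishes_of_epi (h.ext_vanishes X Z hX hZ) p

/-- An object `X` of `C` embeds into an object of `T` with cokernel in `C`; if `X` also lies in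
`Fac T`, then this embedding splits. -/
lemma of_facCat {X : E} (hX : C X) (hX' : FacCat T X) : T X := by
  obtain ⟨T₀, Z, i, p, hT, hZ, hS⟩ := h.exists_embedding X hX
  obtain ⟨r, hr⟩ := (h.extOneVanishes_of_facCat hZ hX').exists_extension hS (𝟙 X)
  exact h.add_closed _ (addClosure_of_retract ⟨i, r, hr⟩ (le_addClosure _ hT))

lemma inf_facCat : C ⊓ FacCat T = T :=
  le_antisymm (fun _ hX => h.of_facCat hX.1 hX.2) fun _ hX => ⟨h.le _ hX, h.le_facCat _ hX⟩

lemma exists_coresolution {X : E} (hX : C X) :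
    ∃ (T₀ T₁ : E) (i : X ⟶ T₀) (p : T₀ ⟶ T₁), T T₀ ∧ T T₁ ∧ IsSES i p := by
  obtain ⟨T₀, Z, i, p, hT, hZ, hS⟩ := h.exists_embedding X hX
  have := hS.epi
  exact ⟨T₀, Z, i, p, hT, h.of_facCat hZ (facCat_of_epi p (h.le_facCat _ hT)), hS⟩

lemma isTilting : IsTilting T where
  add_closed := h.add_closed
  ext_vanishes X Y hX hY := h.ext_vanishes X Y (h.le _ hX) hY
  projDim_le_one X hX := h.projDim_le_one X (h.le _ hX)
  coresolution P hP := h.exists_coresolution (h.of_projective P hP)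
  contravariantlyFinite := h.contravariantlyFinite

lemma leftExtOrthogonal_inf_projDimLEOne : leftExtOrthogonal T ⊓ ProjDimLEOne = C := by
  refine le_antisymm ?_ fun X hX => ⟨fun Y hY => h.ext_vanishes X Y hX hY, h.projDim_le_one X hX⟩
  rintro X ⟨hX, P₁, P₀, i, p, h₁, h₀, hS⟩
  obtain ⟨T₀, T₁, j, q, hT₀, hT₁, hS'⟩ := h.exists_coresolution (h.of_projective P₁ h₁)
  -- The pushout of `P₁ ⟶ P₀ ⟶ X` along `P₁ ⟶ T₀` splits, and its middle term lies in `C`.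
  obtain ⟨Z, a, b, g, hZ, -, -, -, hL⟩ := hS.exists_pushout j
  obtain ⟨l, hl⟩ := hL T₁ q hS'
  obtain ⟨s, hs⟩ := (hX T₀ hT₀).exists_lifting hZ (𝟙 X)
  exact h.of_retract ⟨s, b, hs⟩ (h.of_isSES hl (h.of_projective P₀ h₀) (h.le _ hT₁))

lemma isTorsionPair : IsTorsionPair (FacCat T) T.rightOrthogonal where
  hom_eq_zero X Y f hX hY := by
    obtain ⟨Z, p, hZ, _⟩ := (facCat_iff h.add_closed).1 hX
    rw [← cancel_epi p, comp_zero]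
    exact hY _ hZ
  exists_ses X := by
    obtain ⟨T₀, φ, hT₀, hφ⟩ := h.contravariantlyFinite X
    have hI : FacCat T (Abelian.image φ) := facCat_of_epi (Abelian.factorThruImage φ)
      (h.le_facCat _ hT₀)
    have hS := IsSES.of_mono (Abelian.image.ι φ)
    refine ⟨_, _, Abelian.image.ι φ, _, hI, fun T' f hT' => ?_, hS⟩
    -- A morphism from `T'` to the cokernel lifts to `X`, where it factors through the image.
    obtain ⟨g, rfl⟩ := (h.extOneVanishes_of_facCat (h.le _ hT') hI).exists_lifting hS f
    obtain ⟨k, rfl⟩ := hφ T' g hT'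
    have := congr_arg (· ≫ cokernel.π (Abelian.image.ι φ)) (Abelian.image.fac φ)
    simp only [Category.assoc, hS.zero, comp_zero] at this
    rw [Category.assoc, ← this, comp_zero]

/-- A morphism from an object of `C` to an object of `Fac T` factors through an object of `T`. -/
lemma exists_factorization {X Y : E} (hX : C X) (hY : FacCat T Y) (f : X ⟶ Y) :
    ∃ (Z : E) (a : X ⟶ Z) (b : Z ⟶ Y), T Z ∧ a ≫ b = f := by
  obtain ⟨T₀, Z, i, p, hT, hZ, hS⟩ := h.exists_embedding X hX
  obtain ⟨g, hg⟩ := (h.extOneVanishes_of_facCat hZ hY).exists_extension hS f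
  exact ⟨T₀, i, g, hT, hg⟩

/-- Morphisms of `C` which agree modulo a subobject in `Fac T` agree in `C / T`. -/
lemma toAddQuotient_map_eq {X Y : C.FullSubcategory} {f g : X ⟶ Y} {D M : E} {i : D ⟶ Y.obj}
    {p : Y.obj ⟶ M} (hD : FacCat T D) (hS : IsSES i p) (hfg : f.hom ≫ p = g.hom ≫ p) :
    (toAddQuotient C T).map f = (toAddQuotient C T).map g := by
  obtain ⟨k, hk⟩ := hS.exists_lift (f.hom - g.hom) (by rw [Preadditive.sub_comp, hfg, sub_self])
  obtain ⟨Z, a, b, hZ, hab⟩ := h.exists_factorization X.property hD k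
  exact QuiverTilting.toAddQuotient_map_eq h.le hZ a (b ≫ i) (by rw [reassoc_of% hab, hk])

lemma exists_cotorsionPart (hCD : IsCotorsionPair C (FacCat T)) :
    ∃ c, IsCotorsionPart C (FacCat T) T c := by
  choose d c i p hd hc hS using hCD.exists_ses_left
  have hlift : ∀ {M N : E} (g : M ⟶ N), ∃ l : c M ⟶ c N, l ≫ p N = p M ≫ g := fun {M N} g =>
    (h.extOneVanishes_of_facCat (hc M) (hd N)).exists_lifting (hS N) _
  choose l hl using @hlift
  let cObj (M : E) : C.FullSubcategory := ⟨c M, hc M⟩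
  let lMap {M N : E} (g : M ⟶ N) : cObj M ⟶ cObj N := ObjectProperty.homMk (l g)
  refine ⟨{ obj := fun M => (toAddQuotient C T).obj (cObj M)
            map := fun g => (toAddQuotient C T).map (lMap g)
            map_id := fun M => ?_
            map_comp := fun {M N K} g g' => ?_ },
    cObj, p, fun M => Iso.refl _, fun M => ⟨d M, i M, hd M, hS M⟩,
    fun M N g => ⟨lMap g, hl g, ?_⟩⟩
  · rw [← CategoryTheory.Functor.map_id]
    refine h.toAddQuotient_map_eq (hd M) (hS M) ?_
    change l (𝟙 M) ≫ p M = 𝟙 (c M) ≫ p M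
    rw [hl, Category.id_comp, Category.comp_id]
  · rw [← CategoryTheory.Functor.map_comp]
    refine h.toAddQuotient_map_eq (hd K) (hS K) ?_
    change l (g ≫ g') ≫ p K = (l g ≫ l g') ≫ p K
    rw [hl, Category.assoc, hl, reassoc_of% hl g]
  · rw [Iso.refl_hom, Iso.refl_hom]
    exact (Category.comp_id _).trans (Category.id_comp _).symm

/-- The torsion-free part induces an equivalence from `C / T` to the right orthogonal of `T`,
whose inverse is induced by the left approximation functor of the cotorsion pair. It is full
and essentially surjective because the kernels of `M ⟶ fM` and `cM ⟶ M` lie in `Fac T`, and faithful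
because morphisms from `C` to `Fac T` factor through `T`. -/
lemma exists_equivalence (f : E ⥤ T.rightOrthogonal.FullSubcategory) (c : E ⥤ AddQuotient C T)
    (hf : IsTorsionFreePart (FacCat T) T.rightOrthogonal f)
    (hc : IsCotorsionPart C (FacCat T) T c) :
    ∃ e : AddQuotient C T ≌ T.rightOrthogonal.FullSubcategory,
      Nonempty (toAddQuotient C T ⋙ e.functor ≅ C.ι ⋙ f) ∧
      Nonempty (e.inverse ≅ T.rightOrthogonal.ι ⋙ c) := by
  obtain ⟨η, hη⟩ := hf
  choose t i ht hS using hη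
  have hepi : ∀ M, Epi (η.app M) := fun M => (hS M).epi
  have hnat {M N : E} (g : M ⟶ N) : g ≫ η.app N = η.app M ≫ (f.map g).hom := η.naturality g
  obtain ⟨cObj, p, θ, hp, hl⟩ := hc
  choose d j hd hp using hp
  have H : ∀ (X Y : C.FullSubcategory) (g₁ g₂ : X ⟶ Y), factorRel (T.inverseImage C.ι) g₁ g₂ →
      (C.ι ⋙ f).map g₁ = (C.ι ⋙ f).map g₂ := by
    rintro X Y g₁ g₂ ⟨Z, a, b, hZ, hab⟩
    have hab' : a.hom ≫ b.hom = g₁.hom - g₂.hom := congr_arg (fun k => k.hom) hab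
    ext
    change (f.map g₁.hom).hom = (f.map g₂.hom).hom
    rw [← cancel_epi (η.app X.obj), ← hnat, ← hnat, ← sub_eq_zero, ← Preadditive.sub_comp, ← hab',
      Category.assoc, hnat b.hom]
    have hZ' : η.app Z.obj = 0 :=
      h.isTorsionPair.hom_eq_zero _ _ _ (h.le_facCat _ hZ) (f.obj Z.obj).property
    rw [hZ', zero_comp, comp_zero]
  let G : AddQuotient C T ⥤ T.rightOrthogonal.FullSubcategory :=
    CategoryTheory.Quotient.lift _ (C.ι ⋙ f) H
  have hiso (M : T.rightOrthogonal.FullSubcategory) :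
      ∃ e : (f.obj (cObj M.obj).obj).obj ≅ M.obj, η.app (cObj M.obj).obj ≫ e.hom = p M.obj :=
    exists_iso_of_torsion_ses h.isTorsionPair.hom_eq_zero (hS _) (hp M.obj) (ht _) (hd _)
      (f.obj _).property M.property
  choose e he using hiso
  let ε : (T.rightOrthogonal.ι ⋙ c) ⋙ G ≅ 𝟭 _ :=
    NatIso.ofComponents (fun M => G.mapIso (θ M.obj) ≪≫ ObjectProperty.isoMk _ (e M))
      (fun {M N} g => by
        obtain ⟨l, hl, hl'⟩ := hl M.obj N.obj g.hom
        have h₁ : G.map (c.map g.hom) ≫ G.map (θ N.obj).hom =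
            G.map (θ M.obj).hom ≫ f.map l.hom := by
          rw [← G.map_comp, hl', G.map_comp]
          rfl
        have h₂ : f.map l.hom ≫ (ObjectProperty.isoMk _ (e N)).hom =
            (ObjectProperty.isoMk _ (e M)).hom ≫ g := by
          ext
          change (f.map l.hom).hom ≫ (e N).hom = (e M).hom ≫ g.hom
          rw [← cancel_epi (η.app (cObj M.obj).obj), ← reassoc_of% hnat l.hom, he, reassoc_of% he]
          exact hl
        change G.map (c.map g.hom) ≫ G.map (θ N.obj).hom ≫ _ = (G.map (θ M.obj).hom ≫ _) ≫ g
        rw [reassoc_of% h₁, Category.assoc]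
        exact congr_arg _ h₂)
  have : G.EssSurj := ⟨fun M => ⟨c.obj M.obj, ⟨ε.app M⟩⟩⟩
  have : G.Full := ⟨fun {X Y} k => by
    obtain ⟨X⟩ := X
    obtain ⟨Y⟩ := Y
    obtain ⟨g, hg⟩ := (h.extOneVanishes_of_facCat X.property (ht Y.obj)).exists_lifting
      (hS Y.obj) (η.app X.obj ≫ k.hom)
    refine ⟨(toAddQuotient C T).map (ObjectProperty.homMk g), ?_⟩
    ext
    change (f.map g).hom = k.hom
    rw [← cancel_epi (η.app X.obj), ← hnat]
    exact hg⟩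
  have : G.Faithful := ⟨fun {X Y} g₁ g₂ hg => by
    obtain ⟨X⟩ := X
    obtain ⟨Y⟩ := Y
    obtain ⟨g₁, rfl⟩ := (toAddQuotient C T).map_surjective g₁
    obtain ⟨g₂, rfl⟩ := (toAddQuotient C T).map_surjective g₂
    refine h.toAddQuotient_map_eq (ht Y.obj) (hS Y.obj) ?_
    have hg' : (f.map g₁.hom).hom = (f.map g₂.hom).hom := congr_arg (fun k => k.hom) hg
    exact (hnat g₁.hom).trans ((congr_arg _ hg').trans (hnat g₂.hom).symm)⟩
  have : G.IsEquivalence := {}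
  exact ⟨G.asEquivalence, ⟨CategoryTheory.Quotient.lift.isLift _ _ H⟩,
    ⟨(Functor.leftUnitor _).symm ≪≫ Functor.isoWhiskerRight ε.symm _ ≪≫ Functor.associator _ _ _ ≪≫
      Functor.isoWhiskerLeft _ G.asEquivalence.unitIso.symm ≪≫ Functor.rightUnitor _⟩⟩

variable [EnoughProjectives E]

lemma exists_ses_right (X : E) :
    ∃ (D Z : E) (i : X ⟶ D) (p : D ⟶ Z), FacCat T D ∧ C Z ∧ IsSES i p := by
  obtain ⟨T₀, T₁, j, q, hT₀, hT₁, hS⟩ :=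
    h.exists_coresolution (h.of_projective _ (Projective.projective_over X))
  -- Push out the coresolution of a projective object `P` along an epimorphism `P ⟶ X`.
  obtain ⟨D, a, b, g, hD, -, -, hg, -⟩ := hS.exists_pushout (Projective.π X)
  have := hg inferInstance
  exact ⟨D, T₁, a, b, facCat_of_epi g (h.le_facCat _ hT₀), h.le _ hT₁, hD⟩

lemma exists_ses_left (X : E) :
    ∃ (D Z : E) (i : D ⟶ Z) (p : Z ⟶ X), FacCat T D ∧ C Z ∧ IsSES i p := by
  obtain ⟨D, Z, j, q, hD, hZ, hS⟩ := h.exists_ses_right (kernel (Projective.π X))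
  -- Push out `K ⟶ P ⟶ X` along the embedding of `K` into an object of `Fac T`.
  obtain ⟨Y, a, b, g, hY, -, -, -, hL⟩ := (IsSES.of_epi (Projective.π X)).exists_pushout j
  obtain ⟨l, hl⟩ := hL Z q hS
  exact ⟨D, Y, a, b, hD,
    h.of_isSES hl (h.of_projective _ (Projective.projective_over X)) hZ, hY⟩

lemma isCotorsionPair : IsCotorsionPair C (FacCat T) where
  left_eq := by
    refine le_antisymm (fun X hX Y hY => h.extOneVanishes_of_facCat hX hY) fun X hX => ?_
    obtain ⟨D, Z, i, p, hD, hZ, hS⟩ := h.exists_ses_left X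
    obtain ⟨s, hs⟩ := (hX D hD).exists_lifting hS (𝟙 X)
    exact h.of_retract ⟨s, p, hs⟩ hZ
  right_eq := by
    refine le_antisymm (fun Y hY X hX => h.extOneVanishes_of_facCat hX hY) fun Y hY => ?_
    obtain ⟨D, Z, i, p, hD, hZ, hS⟩ := h.exists_ses_right Y
    obtain ⟨r, hr⟩ := (hY Z hZ).exists_extension hS (𝟙 Y)
    have : IsSplitEpi r := ⟨⟨i, hr⟩⟩
    exact facCat_of_epi r hD
  exists_ses_left := h.exists_ses_left
  exists_ses_right := h.exists_ses_right

end IsTiltingFrame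

end Tilting

/-! ### The cotilting theorem in an abelian category -/

section Cotilting

variable {E : Type u} [Category.{v} E] [Abelian E]

lemma subCat_of_mono {C : ObjectProperty E} {X Y : E} (i : X ⟶ Y) [Mono i] (hY : SubCat C Y) :
    SubCat C X := by
  obtain ⟨Z, hZ, j, hj⟩ := hY
  exact ⟨Z, hZ, i ≫ j, inferInstance⟩

/-- The properties of `D = [Q, Inj A]` and `C = add {P_i(I)}` from which the cotilting theorem
follows formally. This is the dual of `IsTiltingFrame`. -/
structure IsCotiltingFrame (D C : ObjectProperty E) : Prop where
  le : C ≤ D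
  add_closed : ∀ X, addClosure C X → C X
  of_retract : ∀ {X Y : E}, Retract X Y → D Y → D X
  of_isSES : ∀ {X Y Z : E} {i : X ⟶ Y} {p : Y ⟶ Z}, IsSES i p → D X → D Z → D Y
  of_injective : ∀ J : E, Injective J → D J
  injDim_le_one : ∀ X, D X → InjDimLEOne X
  ext_vanishes : ∀ X Y, C X → D Y → ExtOneVanishes X Y
  exists_cover : ∀ X, D X → ∃ (Z C₀ : E) (i : Z ⟶ C₀) (p : C₀ ⟶ X), D Z ∧ C C₀ ∧ IsSES i p
  covariantlyFinite : CovariantlyFinite C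

namespace IsCotiltingFrame

variable {D C : ObjectProperty E} (h : IsCotiltingFrame D C)
include h

lemma le_subCat : C ≤ SubCat C :=
  fun X hX => (subCat_iff h.add_closed).2 ⟨X, 𝟙 X, hX, inferInstance⟩

lemma extOneVanishes_of_subCat {X Y : E} (hX : SubCat C X) (hY : D Y) :
    ExtOneVanishes X Y := by
  obtain ⟨Z, i, hZ, _⟩ := (subCat_iff h.add_closed).1 hX
  exact (h.injDim_le_one Y hY).extOneVanishes_of_mono (h.ext_vanishes Z Y hZ hY) i

/-- An object `X` of `D` is a quotient of an object of `C` with kernel in `D`; if `X` also lies in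
`Sub C`, then this quotient map splits. -/
lemma of_subCat {X : E} (hX : D X) (hX' : SubCat C X) : C X := by
  obtain ⟨Z, C₀, i, p, hZ, hC, hS⟩ := h.exists_cover X hX
  obtain ⟨s, hs⟩ := (h.extOneVanishes_of_subCat hX' hZ).exists_lifting hS (𝟙 X)
  exact h.add_closed _ (addClosure_of_retract ⟨s, p, hs⟩ (le_addClosure _ hC))

lemma subCat_inf : SubCat C ⊓ D = C :=
  le_antisymm (fun _ hX => h.of_subCat hX.2 hX.1) fun _ hX => ⟨h.le_subCat _ hX, h.le _ hX⟩

lemma exists_resolution {X : E} (hX : D X) :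
    ∃ (C₁ C₀ : E) (i : C₁ ⟶ C₀) (p : C₀ ⟶ X), C C₁ ∧ C C₀ ∧ IsSES i p := by
  obtain ⟨Z, C₀, i, p, hZ, hC, hS⟩ := h.exists_cover X hX
  have := hS.mono
  exact ⟨Z, C₀, i, p, h.of_subCat hZ (subCat_of_mono i (h.le_subCat _ hC)), hC, hS⟩

lemma isCotilting : IsCotilting C where
  add_closed := h.add_closed
  ext_vanishes X Y hX hY := h.ext_vanishes X Y hX (h.le _ hY)
  injDim_le_one X hX := h.injDim_le_one X (h.le _ hX)
  resolution J hJ := h.exists_resolution (h.of_injective J hJ)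
  covariantlyFinite := h.covariantlyFinite

lemma rightExtOrthogonal_inf_injDimLEOne : rightExtOrthogonal C ⊓ InjDimLEOne = D := by
  refine le_antisymm ?_ fun X hX => ⟨fun Y hY => h.ext_vanishes Y X hY hX, h.injDim_le_one X hX⟩
  rintro X ⟨hX, J₀, J₁, i, p, h₀, h₁, hS⟩
  obtain ⟨C₁, C₀, j, q, hC₁, hC₀, hS'⟩ := h.exists_resolution (h.of_injective J₁ h₁)
  -- The pullback of `X ⟶ J₀ ⟶ J₁` along `C₀ ⟶ J₁` splits, and its middle term lies in `D`.
  obtain ⟨Z, a, b, g, hZ, -, -, -, hL⟩ := hS.exists_pullback q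
  obtain ⟨l, hl⟩ := hL C₁ j hS'
  obtain ⟨r, hr⟩ := (hX C₀ hC₀).exists_extension hZ (𝟙 X)
  exact h.of_retract ⟨a, r, hr⟩ (h.of_isSES hl (h.le _ hC₁) (h.of_injective J₀ h₀))

lemma isTorsionPair : IsTorsionPair C.leftOrthogonal (SubCat C) where
  hom_eq_zero X Y f hX hY := by
    obtain ⟨Z, i, hZ, _⟩ := (subCat_iff h.add_closed).1 hY
    rw [← cancel_mono i, zero_comp]
    exact hX _ hZ
  exists_ses X := by
    obtain ⟨C₀, ψ, hC₀, hψ⟩ := h.covariantlyFinite X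
    have hI : SubCat C (Abelian.coimage ψ) := subCat_of_mono (Abelian.factorThruCoimage ψ)
      (h.le_subCat _ hC₀)
    have hS := IsSES.of_epi (Abelian.coimage.π ψ)
    refine ⟨_, _, _, Abelian.coimage.π ψ, fun C' f hC' => ?_, hI, hS⟩
    -- A morphism from the kernel to `C'` extends to `X`, and then factors through the coimage.
    obtain ⟨g, rfl⟩ := (h.extOneVanishes_of_subCat hI (h.le _ hC')).exists_extension hS f
    obtain ⟨k, rfl⟩ := hψ C' g hC'
    have := congr_arg (kernel.ι (Abelian.coimage.π ψ) ≫ ·) (Abelian.coimage.fac ψ)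
    simp only [reassoc_of% hS.zero, zero_comp] at this
    rw [← Category.assoc, ← this, zero_comp]

/-- A morphism from an object of `Sub C` to an object of `D` factors through an object of `C`. -/
lemma exists_factorization {X Y : E} (hX : SubCat C X) (hY : D Y) (f : X ⟶ Y) :
    ∃ (Z : E) (a : X ⟶ Z) (b : Z ⟶ Y), C Z ∧ a ≫ b = f := by
  obtain ⟨Z, C₀, i, p, hZ, hC, hS⟩ := h.exists_cover Y hY
  obtain ⟨g, hg⟩ := (h.extOneVanishes_of_subCat hX hZ).exists_lifting hS f
  exact ⟨C₀, g, p, hC, hg⟩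

/-- Morphisms of `D` which agree on a subobject with quotient in `Sub C` agree in `D / C`. -/
lemma toAddQuotient_map_eq {X Y : D.FullSubcategory} {f g : X ⟶ Y} {M Z : E} {i : M ⟶ X.obj}
    {p : X.obj ⟶ Z} (hZ : SubCat C Z) (hS : IsSES i p) (hfg : i ≫ f.hom = i ≫ g.hom) :
    (toAddQuotient D C).map f = (toAddQuotient D C).map g := by
  obtain ⟨k, hk⟩ := hS.exists_desc (f.hom - g.hom) (by rw [Preadditive.comp_sub, hfg, sub_self])
  obtain ⟨W, a, b, hW, hab⟩ := h.exists_factorization hZ Y.property k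
  exact QuiverTilting.toAddQuotient_map_eq h.le hW (p ≫ a) b (by rw [Category.assoc, hab, hk])

lemma exists_cotorsionFreePart (hCD : IsCotorsionPair (SubCat C) D) :
    ∃ d, IsCotorsionFreePart (SubCat C) D C d := by
  choose d c i p hd hc hS using hCD.exists_ses_right
  have hext : ∀ {M N : E} (g : M ⟶ N), ∃ l : d M ⟶ d N, i M ≫ l = g ≫ i N := fun {M N} g =>
    (h.extOneVanishes_of_subCat (hc M) (hd N)).exists_extension (hS M) _
  choose l hl using @hext
  let dObj (M : E) : D.FullSubcategory := ⟨d M, hd M⟩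
  let lMap {M N : E} (g : M ⟶ N) : dObj M ⟶ dObj N := ObjectProperty.homMk (l g)
  refine ⟨{ obj := fun M => (toAddQuotient D C).obj (dObj M)
            map := fun g => (toAddQuotient D C).map (lMap g)
            map_id := fun M => ?_
            map_comp := fun {M N K} g g' => ?_ },
    dObj, i, fun M => Iso.refl _, fun M => ⟨c M, p M, hc M, hS M⟩,
    fun M N g => ⟨lMap g, hl g, ?_⟩⟩
  · rw [← CategoryTheory.Functor.map_id]
    refine h.toAddQuotient_map_eq (hc M) (hS M) ?_
    change i M ≫ l (𝟙 M) = i M ≫ 𝟙 (d M)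
    rw [hl, Category.id_comp, Category.comp_id]
  · rw [← CategoryTheory.Functor.map_comp]
    refine h.toAddQuotient_map_eq (hc M) (hS M) ?_
    change i M ≫ l (g ≫ g') = i M ≫ l g ≫ l g'
    rw [hl, reassoc_of% hl g, hl, Category.assoc]
  · rw [Iso.refl_hom, Iso.refl_hom]
    exact (Category.comp_id _).trans (Category.id_comp _).symm

/-- The torsion part induces an equivalence from `D / C` to the left orthogonal of `C`, whose
inverse is induced by the right approximation functor of the cotorsion pair. It is full and
essentially surjective because the cokernels of `tM ⟶ M` and `M ⟶ dM` lie in `Sub C`, and faithful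
because morphisms from `Sub C` to `D` factor through `C`. -/
lemma exists_equivalence (t : E ⥤ C.leftOrthogonal.FullSubcategory) (d : E ⥤ AddQuotient D C)
    (ht : IsTorsionPart C.leftOrthogonal (SubCat C) t)
    (hd : IsCotorsionFreePart (SubCat C) D C d) :
    ∃ e : AddQuotient D C ≌ C.leftOrthogonal.FullSubcategory,
      Nonempty (toAddQuotient D C ⋙ e.functor ≅ D.ι ⋙ t) ∧
      Nonempty (e.inverse ≅ C.leftOrthogonal.ι ⋙ d) := by
  obtain ⟨η, hη⟩ := ht
  choose f q hf hS using hη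
  have hmono : ∀ M, Mono (η.app M) := fun M => (hS M).mono
  have hnat {M N : E} (g : M ⟶ N) : (t.map g).hom ≫ η.app N = η.app M ≫ g := η.naturality g
  obtain ⟨dObj, i, θ, hi, hl⟩ := hd
  choose c p hc hi using hi
  have H : ∀ (X Y : D.FullSubcategory) (g₁ g₂ : X ⟶ Y), factorRel (C.inverseImage D.ι) g₁ g₂ →
      (D.ι ⋙ t).map g₁ = (D.ι ⋙ t).map g₂ := by
    rintro X Y g₁ g₂ ⟨Z, a, b, hZ, hab⟩
    have hab' : a.hom ≫ b.hom = g₁.hom - g₂.hom := congr_arg (fun k => k.hom) hab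
    ext
    change (t.map g₁.hom).hom = (t.map g₂.hom).hom
    rw [← cancel_mono (η.app Y.obj), hnat, hnat, ← sub_eq_zero, ← Preadditive.comp_sub, ← hab',
      ← Category.assoc, ← hnat a.hom]
    have hZ' : η.app Z.obj = 0 :=
      h.isTorsionPair.hom_eq_zero _ _ _ (t.obj Z.obj).property (h.le_subCat _ hZ)
    rw [hZ', comp_zero, zero_comp]
  let G : AddQuotient D C ⥤ C.leftOrthogonal.FullSubcategory :=
    CategoryTheory.Quotient.lift _ (D.ι ⋙ t) H
  have hiso (M : C.leftOrthogonal.FullSubcategory) :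
      ∃ e : (t.obj (dObj M.obj).obj).obj ≅ M.obj, e.hom ≫ i M.obj = η.app (dObj M.obj).obj :=
    exists_iso_of_torsionFree_ses h.isTorsionPair.hom_eq_zero (hS _) (hi M.obj) (hf _) (hc _)
      (t.obj _).property M.property
  choose e he using hiso
  let ε : (C.leftOrthogonal.ι ⋙ d) ⋙ G ≅ 𝟭 _ :=
    NatIso.ofComponents (fun M => G.mapIso (θ M.obj) ≪≫ ObjectProperty.isoMk _ (e M))
      (fun {M N} g => by
        obtain ⟨l, hl, hl'⟩ := hl M.obj N.obj g.hom
        have h₁ : G.map (d.map g.hom) ≫ G.map (θ N.obj).hom =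
            G.map (θ M.obj).hom ≫ t.map l.hom := by
          rw [← G.map_comp, hl', G.map_comp]
          rfl
        have h₂ : t.map l.hom ≫ (ObjectProperty.isoMk _ (e N)).hom =
            (ObjectProperty.isoMk _ (e M)).hom ≫ g := by
          ext
          change (t.map l.hom).hom ≫ (e N).hom = (e M).hom ≫ g.hom
          have := (hi N.obj).mono
          rw [← cancel_mono (i N.obj), Category.assoc, Category.assoc, he, hnat, ← hl,
            reassoc_of% he]
          rfl
        change G.map (d.map g.hom) ≫ G.map (θ N.obj).hom ≫ _ = (G.map (θ M.obj).hom ≫ _) ≫ g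
        rw [reassoc_of% h₁, Category.assoc]
        exact congr_arg _ h₂)
  have : G.EssSurj := ⟨fun M => ⟨d.obj M.obj, ⟨ε.app M⟩⟩⟩
  have : G.Full := ⟨fun {X Y} k => by
    obtain ⟨X⟩ := X
    obtain ⟨Y⟩ := Y
    obtain ⟨g, hg⟩ := (h.extOneVanishes_of_subCat (hf X.obj) Y.property).exists_extension
      (hS X.obj) (k.hom ≫ η.app Y.obj)
    refine ⟨(toAddQuotient D C).map (ObjectProperty.homMk g), ?_⟩
    ext
    change (t.map g).hom = k.hom
    rw [← cancel_mono (η.app Y.obj), hnat]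
    exact hg⟩
  have : G.Faithful := ⟨fun {X Y} g₁ g₂ hg => by
    obtain ⟨X⟩ := X
    obtain ⟨Y⟩ := Y
    obtain ⟨g₁, rfl⟩ := (toAddQuotient D C).map_surjective g₁
    obtain ⟨g₂, rfl⟩ := (toAddQuotient D C).map_surjective g₂
    refine h.toAddQuotient_map_eq (hf X.obj) (hS X.obj) ?_
    have hg' : (t.map g₁.hom).hom = (t.map g₂.hom).hom := congr_arg (fun k => k.hom) hg
    exact (hnat g₁.hom).symm.trans ((congr_arg (· ≫ _) hg').trans (hnat g₂.hom))⟩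
  have : G.IsEquivalence := {}
  exact ⟨G.asEquivalence, ⟨CategoryTheory.Quotient.lift.isLift _ _ H⟩,
    ⟨(Functor.leftUnitor _).symm ≪≫ Functor.isoWhiskerRight ε.symm _ ≪≫ Functor.associator _ _ _ ≪≫
      Functor.isoWhiskerLeft _ G.asEquivalence.unitIso.symm ≪≫ Functor.rightUnitor _⟩⟩

variable [EnoughInjectives E]

lemma exists_ses_left (X : E) :
    ∃ (Y Z : E) (i : Y ⟶ Z) (p : Z ⟶ X), D Y ∧ SubCat C Z ∧ IsSES i p := by
  obtain ⟨C₁, C₀, j, q, hC₁, hC₀, hS⟩ :=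
    h.exists_resolution (h.of_injective (Injective.under X) inferInstance)
  -- Pull back the resolution of an injective object `J` along a monomorphism `X ⟶ J`.
  obtain ⟨Z, a, b, g, hZ, -, -, hg, -⟩ := hS.exists_pullback (Injective.ι X)
  have := hg inferInstance
  exact ⟨C₁, Z, a, b, h.le _ hC₁, subCat_of_mono g (h.le_subCat _ hC₀), hZ⟩

lemma exists_ses_right (X : E) :
    ∃ (Y Z : E) (i : X ⟶ Y) (p : Y ⟶ Z), D Y ∧ SubCat C Z ∧ IsSES i p := by
  obtain ⟨Y, Z, j, q, hY, hZ, hS⟩ := h.exists_ses_left (cokernel (Injective.ι X))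
  -- Pull back `X ⟶ J ⟶ L` along the surjection from an object of `Sub C` to `L`.
  obtain ⟨W, a, b, g, hW, -, -, -, hL⟩ := (IsSES.of_mono (Injective.ι X)).exists_pullback q
  obtain ⟨l, hl⟩ := hL Y j hS
  exact ⟨W, Z, a, b,
    h.of_isSES hl hY (h.of_injective (Injective.under X) inferInstance), hZ, hW⟩

lemma isCotorsionPair : IsCotorsionPair (SubCat C) D where
  left_eq := by
    refine le_antisymm (fun X hX Y hY => h.extOneVanishes_of_subCat hX hY) fun X hX => ?_
    obtain ⟨Y, Z, i, p, hY, hZ, hS⟩ := h.exists_ses_left X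
    obtain ⟨s, hs⟩ := (hX Y hY).exists_lifting hS (𝟙 X)
    have : IsSplitMono s := ⟨⟨p, hs⟩⟩
    exact subCat_of_mono s hZ
  right_eq := by
    refine le_antisymm (fun Y hY X hX => h.extOneVanishes_of_subCat hX hY) fun X hX => ?_
    obtain ⟨Y, Z, i, p, hY, hZ, hS⟩ := h.exists_ses_right X
    obtain ⟨r, hr⟩ := (hX Z hZ).exists_extension hS (𝟙 X)
    exact h.of_retract ⟨i, r, hr⟩ hY
  exists_ses_left := h.exists_ses_left
  exists_ses_right := h.exists_ses_right

end IsCotiltingFrame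

end Cotilting

/-! ### Projective and injective terms of short exact sequences -/

namespace IsSES

variable {E : Type u} [Category.{v} E] [Abelian E] {X Y Z : E} {i : X ⟶ Y} {p : Y ⟶ Z}

lemma exists_retract_biprod (h : IsSES i p) {s : Z ⟶ Y} (hs : s ≫ p = 𝟙 Z) :
    Nonempty (Retract Y (X ⊞ Z)) := by
  obtain ⟨r, -, hr⟩ := h.exists_retraction hs
  exact ⟨⟨biprod.lift r p, biprod.desc i s, by rw [biprod.lift_desc, hr]⟩⟩

lemma projective (h : IsSES i p) (_ : Projective X) (_ : Projective Z) : Projective Y := by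
  have := h.epi
  obtain ⟨r⟩ := h.exists_retract_biprod (Projective.factorThru_comp (𝟙 Z) p)
  exact r.projective

lemma injective (h : IsSES i p) (_ : Injective X) (_ : Injective Z) : Injective Y := by
  have := h.mono
  obtain ⟨s, hs, -⟩ := h.exists_section (Injective.comp_factorThru (𝟙 X) i)
  obtain ⟨r⟩ := h.exists_retract_biprod hs
  exact r.injective

/-- If `Y ⟶ Z` is an epimorphism from a projective object and every extension of `Z` lifts along
epimorphisms of its left term, i.e. `Ext²(Z, -) = 0`, then the kernel of `Y ⟶ Z` is projective. -/
lemma projective_of_ext_lifting (h : IsSES i p) [Projective Y]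
    (H : ∀ {K L M : E} (π : K ⟶ L) {j : L ⟶ M} {q : M ⟶ Z}, Epi π → IsSES j q →
      ∃ (M' : E) (j' : K ⟶ M') (q' : M' ⟶ Z) (g : M' ⟶ M),
        IsSES j' q' ∧ g ≫ q = q' ∧ j' ≫ g = π ≫ j) :
    Projective X where
  factors {L K} k π _ := by
    obtain ⟨M, j, q, g, hM, hg, hg', -, -⟩ := h.exists_pushout k
    obtain ⟨M', j', q', g', hM', hq, hj⟩ := H π inferInstance hM
    have := hM.mono
    have := hM'.epi
    let a := Projective.factorThru p q'
    have ha : a ≫ q' = p := Projective.factorThru_comp p q'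
    obtain ⟨b, hb⟩ := hM'.exists_lift (i ≫ a) (by rw [Category.assoc, ha, h.zero])
    -- `a ≫ g'` and `g` both lie over `p`, so that they differ by a morphism from `Y` to `L`.
    obtain ⟨c, hc⟩ := hM.exists_lift (a ≫ g' - g) (by
      rw [Preadditive.sub_comp, Category.assoc, hq, ha, hg, sub_self])
    refine ⟨b - i ≫ Projective.factorThru c π, ?_⟩
    rw [← cancel_mono j, Preadditive.sub_comp, Preadditive.sub_comp, Category.assoc, Category.assoc,
      Category.assoc, Projective.factorThru_comp_assoc, hc, ← hj, reassoc_of% hb, Preadditive.comp_sub,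
      hg', sub_sub_cancel]

/-- If `X ⟶ Y` is a monomorphism to an injective object and every extension by `X` extends along
monomorphisms of its right term, i.e. `Ext²(-, X) = 0`, then the cokernel of `X ⟶ Y` is
injective. -/
lemma injective_of_ext_extension (h : IsSES i p) [Injective Y]
    (H : ∀ {K L M : E} (m : K ⟶ L) {j : X ⟶ M} {q : M ⟶ K}, Mono m → IsSES j q →
      ∃ (M' : E) (j' : X ⟶ M') (q' : M' ⟶ L) (g : M ⟶ M'),
        IsSES j' q' ∧ j ≫ g = j' ∧ g ≫ q' = q ≫ m) :
    Injective Z where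
  factors {K L} k m _ := by
    obtain ⟨M, j, q, g, hM, hg, hg', -, -⟩ := h.exists_pullback k
    obtain ⟨M', j', q', g', hM', hj, hq⟩ := H m inferInstance hM
    have := hM.epi
    have := hM'.mono
    let a := Injective.factorThru i j'
    have ha : j' ≫ a = i := Injective.comp_factorThru i j'
    obtain ⟨b, hb⟩ := hM'.exists_desc (a ≫ p) (by rw [reassoc_of% ha, h.zero])
    -- `g' ≫ a` and `g` agree on `X`, so that they differ by a morphism from `K` to `Y`.
    obtain ⟨c, hc⟩ := hM.exists_desc (g' ≫ a - g) (by
      rw [Preadditive.comp_sub, reassoc_of% hj, ha, hg, sub_self])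
    refine ⟨b - Injective.factorThru c m ≫ p, ?_⟩
    rw [← cancel_epi q, Preadditive.comp_sub, Preadditive.comp_sub,
      Injective.comp_factorThru_assoc, reassoc_of% hc, ← reassoc_of% hq, hb, Preadditive.sub_comp,
      hg', Category.assoc, sub_sub_cancel]

end IsSES

/-! ### Short exact sequences of functors -/

section FunctorCategory

variable {J : Type w} [Category.{w'} J] {A : Type u} [Category.{v} A] [Abelian A]

lemma IsSES.app {X Y Z : J ⥤ A} {i : X ⟶ Y} {p : Y ⟶ Z} (h : IsSES i p) (j : J) :
    IsSES (i.app j) (p.app j) := by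
  obtain ⟨w, hS⟩ := h
  have := hS.mono_f
  have := hS.epi_g
  have : Mono (((evaluation J A).obj j).map i) := (NatTrans.mono_iff_mono_app i).1 hS.mono_f j
  have : Epi (((evaluation J A).obj j).map p) := (NatTrans.epi_iff_epi_app p).1 hS.epi_g j
  exact ⟨_, hS.map ((evaluation J A).obj j)⟩

lemma IsSES.of_app {X Y Z : J ⥤ A} {i : X ⟶ Y} {p : Y ⟶ Z}
    (h : ∀ j, IsSES (i.app j) (p.app j)) : IsSES i p := by
  have hi : ∀ j, Mono (i.app j) := fun j => (h j).mono
  have hp : ∀ j, Epi (p.app j) := fun j => (h j).epi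
  have := NatTrans.mono_of_mono_app i
  have := NatTrans.epi_of_epi_app p
  refine IsSES.of_exists_lift (by ext j; exact (h j).zero) fun W f hf => ?_
  choose g hg using fun j => (h j).exists_lift (f.app j) (NatTrans.congr_app hf j)
  refine ⟨{ app := g, naturality := fun j k a => ?_ }, by ext j; exact hg j⟩
  rw [← cancel_mono (i.app k), Category.assoc, Category.assoc, hg, i.naturality,
    reassoc_of% hg j, f.naturality]

end FunctorCategory

/-! ### Extensions of representations -/

section TwistedExtension

variable {Q : Type w} [Quiver.{w'} Q] {A : Type u} [Category.{v} A] [Abelian A]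

/-- The extension of `X` by `Y` attached to a family `c` of morphisms from `X` to `Y` indexed by
the arrows of `Q`: at a vertex `i` it is `Y_i ⊞ X_i`, and an arrow acts on it by the
triangular matrix formed by its actions on `Y` and `X` and by `c`. -/
def twistedExtension (Y X : QRep Q A)
    (c : ∀ {i j : Q}, (i ⟶ j) → (X.obj ((Paths.of Q).obj i) ⟶ Y.obj ((Paths.of Q).obj j))) :
    QRep Q A :=
  Paths.lift
    { obj := fun i => Y.obj ((Paths.of Q).obj i) ⊞ X.obj ((Paths.of Q).obj i)
      map := fun a => biprod.desc (Y.map ((Paths.of Q).map a) ≫ biprod.inl)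
        (c a ≫ biprod.inl + X.map ((Paths.of Q).map a) ≫ biprod.inr) }

variable {X Y : QRep Q A}
  (c : ∀ {i j : Q}, (i ⟶ j) → (X.obj ((Paths.of Q).obj i) ⟶ Y.obj ((Paths.of Q).obj j)))

lemma twistedExtension_map {i j : Q} (a : i ⟶ j) :
    (twistedExtension Y X c).map ((Paths.of Q).map a) =
      biprod.desc (Y.map ((Paths.of Q).map a) ≫ biprod.inl)
        (c a ≫ biprod.inl + X.map ((Paths.of Q).map a) ≫ biprod.inr) :=
  Paths.lift_toPath _ a

/-- A family of morphisms compatible with the arrows of `Q` is a morphism of representations. -/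
def repHomMk {X Y : QRep Q A} (f : ∀ k : Paths Q, X.obj k ⟶ Y.obj k)
    (hf : ∀ {i j : Q} (a : i ⟶ j), X.map ((Paths.of Q).map a) ≫ f ((Paths.of Q).obj j) =
      f ((Paths.of Q).obj i) ≫ Y.map ((Paths.of Q).map a)) : X ⟶ Y :=
  Paths.liftNatTrans f hf

/-- The inclusion of `Y` into the extension. -/
def twistedExtensionInl : Y ⟶ twistedExtension Y X c :=
  repHomMk (fun _ => biprod.inl) fun a =>
    (biprod.inl_desc _ _).symm.trans (congr_arg (_ ≫ ·) (twistedExtension_map c a).symm)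

/-- A morphism from the extension to `M` consists of a morphism from `Y` to `M` and morphisms from
`X_k` to `M_k` which are natural up to the twist. -/
def twistedExtensionDesc {M : QRep Q A} (f : Y ⟶ M) (s : ∀ k : Paths Q, X.obj k ⟶ M.obj k)
    (hs : ∀ {i j : Q} (a : i ⟶ j), c a ≫ f.app ((Paths.of Q).obj j) +
      X.map ((Paths.of Q).map a) ≫ s ((Paths.of Q).obj j) =
        s ((Paths.of Q).obj i) ≫ M.map ((Paths.of Q).map a)) :
    twistedExtension Y X c ⟶ M :=
  repHomMk (fun k => biprod.desc (f.app k) (s k)) fun {i j} a => by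
    have : biprod.desc (Y.map ((Paths.of Q).map a) ≫ biprod.inl)
        (c a ≫ biprod.inl + X.map ((Paths.of Q).map a) ≫ biprod.inr) ≫
        biprod.desc (f.app ((Paths.of Q).obj j)) (s ((Paths.of Q).obj j)) =
        biprod.desc (f.app ((Paths.of Q).obj i)) (s ((Paths.of Q).obj i)) ≫
          M.map ((Paths.of Q).map a) := by
      apply biprod.hom_ext'
      · simp only [biprod.inl_desc_assoc, Category.assoc, biprod.inl_desc]
        exact f.naturality _
      · simp only [biprod.inr_desc_assoc, Category.assoc, biprod.inl_desc, biprod.inr_desc,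
          Preadditive.add_comp]
        exact hs a
    exact (congr_arg (· ≫ _) (twistedExtension_map c a)).trans this

/-- A morphism from `M` to the extension consists of a morphism from `M` to `X` and morphisms from
`M_k` to `Y_k` which are natural up to the twist. -/
def twistedExtensionLift {M : QRep Q A} (r : ∀ k : Paths Q, M.obj k ⟶ Y.obj k) (f : M ⟶ X)
    (hr : ∀ {i j : Q} (a : i ⟶ j), r ((Paths.of Q).obj i) ≫ Y.map ((Paths.of Q).map a) +
      f.app ((Paths.of Q).obj i) ≫ c a =
        M.map ((Paths.of Q).map a) ≫ r ((Paths.of Q).obj j)) :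
    M ⟶ twistedExtension Y X c :=
  repHomMk (fun k => biprod.lift (r k) (f.app k)) fun {i j} a => by
    have : M.map ((Paths.of Q).map a) ≫
        biprod.lift (r ((Paths.of Q).obj j)) (f.app ((Paths.of Q).obj j)) =
        biprod.lift (r ((Paths.of Q).obj i)) (f.app ((Paths.of Q).obj i)) ≫
        biprod.desc (Y.map ((Paths.of Q).map a) ≫ biprod.inl)
          (c a ≫ biprod.inl + X.map ((Paths.of Q).map a) ≫ biprod.inr) := by
      apply biprod.hom_ext
      · simp only [Category.assoc, biprod.lift_fst, biprod.lift_desc, Preadditive.comp_add,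
          Preadditive.add_comp, biprod.inl_fst, biprod.inr_fst, comp_zero, Category.comp_id,
          add_zero]
        exact (hr a).symm
      · simp only [Category.assoc, biprod.lift_snd, biprod.lift_desc, Preadditive.comp_add,
          Preadditive.add_comp, biprod.inl_snd, biprod.inr_snd, comp_zero, Category.comp_id,
          zero_add]
        exact f.naturality _
    exact this.trans (congr_arg (_ ≫ ·) (twistedExtension_map c a).symm)

/-- The projection of the extension onto `X`. -/
def twistedExtensionSnd : twistedExtension Y X c ⟶ X :=
  twistedExtensionDesc c 0 (fun _ => 𝟙 _) fun a => by
    rw [Category.id_comp, Category.comp_id]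
    exact (congr_arg (· + _) comp_zero).trans (zero_add _)

lemma twistedExtensionSnd_app (k : Paths Q) :
    (twistedExtensionSnd c).app k = (biprod.snd : Y.obj k ⊞ X.obj k ⟶ X.obj k) := by
  apply biprod.hom_ext'
  · exact (biprod.inl_desc _ _).trans biprod.inl_snd.symm
  · exact (biprod.inr_desc _ _).trans biprod.inr_snd.symm

lemma isSES_twistedExtension : IsSES (twistedExtensionInl c) (twistedExtensionSnd c) :=
  IsSES.of_app fun k => by
    rw [twistedExtensionSnd_app]
    exact IsSES.of_exists_lift (i := biprod.inl) (p := biprod.snd)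
      (biprod.inl_snd (X := Y.obj k) (Y := X.obj k)) fun W f hf =>
        ⟨f ≫ biprod.fst, by apply biprod.hom_ext <;> simp [hf]⟩

/-- `Ext²(X, -) = 0` for a representation `X` which is projective at every vertex: an extension of
`X` splits at every vertex, so it is a twisted extension, and the family of morphisms that
defines it lifts along epimorphisms. -/
lemma repProj.exists_ext_lifting (hX : repProj Q A X) {K L M : QRep Q A} (π : K ⟶ L) {j : L ⟶ M}
    {q : M ⟶ X} (hπ : Epi π) (hM : IsSES j q) :
    ∃ (M' : QRep Q A) (j' : K ⟶ M') (q' : M' ⟶ X) (g : M' ⟶ M),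
      IsSES j' q' ∧ g ≫ q = q' ∧ j' ≫ g = π ≫ j := by
  have hq : ∀ k, Epi (q.app k) := fun k => (hM.app k).epi
  have hπ' : ∀ k, Epi (π.app k) := (NatTrans.epi_iff_epi_app π).1 hπ
  have hX' (k : Paths Q) : Projective (X.obj k) := hX k
  let s (k : Paths Q) : X.obj k ⟶ M.obj k := Projective.factorThru (𝟙 _) (q.app k)
  have hs (k : Paths Q) : s k ≫ q.app k = 𝟙 _ := Projective.factorThru_comp _ _
  have hc {k l : Paths Q} (a : k ⟶ l) : ∃ c : X.obj k ⟶ K.obj l,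
      c ≫ π.app l ≫ j.app l = s k ≫ M.map a - X.map a ≫ s l := by
    obtain ⟨c', hc'⟩ := (hM.app l).exists_lift (s k ≫ M.map a - X.map a ≫ s l) (by
      rw [Preadditive.sub_comp, Category.assoc, Category.assoc, hs, q.naturality,
        reassoc_of% hs k, Category.comp_id, sub_self])
    exact ⟨Projective.factorThru c' (π.app l), by rw [Projective.factorThru_comp_assoc, hc']⟩
  choose c hc using @hc
  let c' {k l : Q} (a : k ⟶ l) := c ((Paths.of Q).map a)
  refine ⟨twistedExtension K X c', twistedExtensionInl c', twistedExtensionSnd c',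
    twistedExtensionDesc c' (π ≫ j) s fun {k l} a =>
      (congr_arg (· + _) (hc ((Paths.of Q).map a))).trans (sub_add_cancel _ _),
    isSES_twistedExtension c', ?_, ?_⟩
  · ext k
    rw [twistedExtensionSnd_app]
    have : biprod.desc (π.app k ≫ j.app k) (s k) ≫ q.app k = biprod.snd := by
      apply biprod.hom_ext' <;> simp [hs, (hM.app k).zero]
    exact this
  · ext k
    exact biprod.inl_desc _ _

/-- `Ext²(-, X) = 0` for a representation `X` which is injective at every vertex: an extension by
`X` splits at every vertex, so it is a twisted extension, and the family of morphisms that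
defines it extends along monomorphisms. -/
lemma repInj.exists_ext_extension (hX : repInj Q A X) {K L M : QRep Q A} (m : K ⟶ L) {j : X ⟶ M}
    {q : M ⟶ K} (hm : Mono m) (hM : IsSES j q) :
    ∃ (M' : QRep Q A) (j' : X ⟶ M') (q' : M' ⟶ L) (g : M ⟶ M'),
      IsSES j' q' ∧ j ≫ g = j' ∧ g ≫ q' = q ≫ m := by
  have hj : ∀ k, Mono (j.app k) := fun k => (hM.app k).mono
  have hm' : ∀ k, Mono (m.app k) := (NatTrans.mono_iff_mono_app m).1 hm
  have hX' (k : Paths Q) : Injective (X.obj k) := hX k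
  let r (k : Paths Q) : M.obj k ⟶ X.obj k := Injective.factorThru (𝟙 _) (j.app k)
  have hr (k : Paths Q) : j.app k ≫ r k = 𝟙 _ := Injective.comp_factorThru _ _
  have hc {k l : Paths Q} (a : k ⟶ l) : ∃ c : L.obj k ⟶ X.obj l,
      q.app k ≫ m.app k ≫ c = M.map a ≫ r l - r k ≫ X.map a := by
    obtain ⟨c', hc'⟩ := (hM.app k).exists_desc (M.map a ≫ r l - r k ≫ X.map a) (by
      rw [Preadditive.comp_sub, ← j.naturality_assoc, hr, reassoc_of% hr k, Category.comp_id,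
        sub_self])
    exact ⟨Injective.factorThru c' (m.app k), by rw [Injective.comp_factorThru, hc']⟩
  choose c hc using @hc
  let c' {k l : Q} (a : k ⟶ l) := c ((Paths.of Q).map a)
  refine ⟨twistedExtension X L c', twistedExtensionInl c', twistedExtensionSnd c',
    twistedExtensionLift c' r (q ≫ m) fun {k l} a =>
      (congr_arg (_ + ·) ((Category.assoc _ _ _).trans (hc ((Paths.of Q).map a)))).trans
        (add_sub_cancel _ _),
    isSES_twistedExtension c', ?_, ?_⟩
  · ext k
    have : j.app k ≫ biprod.lift (r k) (q.app k ≫ m.app k) = biprod.inl := by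
      apply biprod.hom_ext <;> simp [hr, reassoc_of% (hM.app k).zero]
    exact this
  · ext k
    rw [NatTrans.comp_app, twistedExtensionSnd_app]
    exact biprod.lift_snd _ _

end TwistedExtension

/-! ### Morphisms out of coinduced functors -/

section Families

variable {J : Type w} [Category.{w'} J] [∀ i j : J, Fintype (i ⟶ j)]
variable {A : Type u} [Category.{v} A] [Abelian A]

open Classical in
/-- The condition under which morphisms `f p : M ⟶ X_j`, indexed by the morphisms `p : j ⟶ i`, are
the components of a morphism from `I_i(M) = ⨁_{j ⟶ i} M` to `X`. -/
def IsCoinducedFamily (X : J ⥤ A) {i : J} {M : A} (f : ∀ ⦃j : J⦄, (j ⟶ i) → (M ⟶ X.obj j)) :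
    Prop :=
  ∀ ⦃j k : J⦄ (a : j ⟶ k) (p : j ⟶ i),
    f p ≫ X.map a = ∑ q : k ⟶ i, if a ≫ q = p then f q else 0

variable {X : J ⥤ A} {i : J} {M : A}

/-- The projection of `I_i(M)_j` onto the summand indexed by `p : j ⟶ i`. -/
def coinducedπ (M : A) {j : J} (p : j ⟶ i) :
    ((evaluationRightAdjoint A i).obj M).obj j ⟶ M :=
  Pi.π (fun _ : j ⟶ i => M) p

open Classical in
/-- The inclusion of the summand of `I_i(M)_j` indexed by `p : j ⟶ i`. -/
def coinducedι (M : A) {j : J} (p : j ⟶ i) :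
    M ⟶ ((evaluationRightAdjoint A i).obj M).obj j :=
  Pi.lift fun q => if q = p then 𝟙 M else 0

lemma coinduced_hom_ext {j : J} {Z : A} {f g : Z ⟶ ((evaluationRightAdjoint A i).obj M).obj j}
    (h : ∀ p : j ⟶ i, f ≫ coinducedπ M p = g ≫ coinducedπ M p) : f = g :=
  Pi.hom_ext _ _ h

open Classical in
lemma coinducedι_π {j : J} (p q : j ⟶ i) :
    coinducedι M p ≫ coinducedπ M q = if q = p then 𝟙 M else 0 :=
  Pi.lift_π _ _

lemma coinduced_map_π {j k : J} (a : j ⟶ k) (q : k ⟶ i) :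
    ((evaluationRightAdjoint A i).obj M).map a ≫ coinducedπ M q = coinducedπ M (a ≫ q) :=
  Pi.lift_π _ _

lemma coinduced_app_π {N : A} (f : M ⟶ N) {j : J} (q : j ⟶ i) :
    ((evaluationRightAdjoint A i).map f).app j ≫ coinducedπ N q = coinducedπ M q ≫ f :=
  Pi.lift_π _ _

lemma coinduced_total (j : J) :
    ∑ p : j ⟶ i, coinducedπ M p ≫ coinducedι M p =
      𝟙 (((evaluationRightAdjoint A i).obj M).obj j) := by
  classical
  refine coinduced_hom_ext fun q => ?_
  rw [Preadditive.sum_comp]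
  simp only [Category.assoc, coinducedι_π, comp_ite, comp_zero]
  rw [Finset.sum_ite_eq, if_pos (Finset.mem_univ _), Category.comp_id, Category.id_comp]

lemma coinduced_hom_ext' {j : J} {Z : A} {f g : ((evaluationRightAdjoint A i).obj M).obj j ⟶ Z}
    (h : ∀ p : j ⟶ i, coinducedι M p ≫ f = coinducedι M p ≫ g) : f = g := by
  rw [← Category.id_comp f, ← Category.id_comp g, ← coinduced_total, Preadditive.sum_comp,
    Preadditive.sum_comp]
  simp only [Category.assoc, h]

lemma coinducedι_app {N : A} (f : M ⟶ N) {j : J} (p : j ⟶ i) :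
    coinducedι M p ≫ ((evaluationRightAdjoint A i).map f).app j = f ≫ coinducedι N p := by
  classical
  refine coinduced_hom_ext fun q => ?_
  rw [Category.assoc, Category.assoc, coinduced_app_π, coinducedι_π, reassoc_of% coinducedι_π]
  split_ifs <;> simp

open Classical in
lemma coinducedι_map {j k : J} (a : j ⟶ k) (p : j ⟶ i) :
    coinducedι M p ≫ ((evaluationRightAdjoint A i).obj M).map a =
      ∑ q : k ⟶ i, if a ≫ q = p then coinducedι M q else 0 := by
  refine coinduced_hom_ext fun q => ?_
  rw [Category.assoc, coinduced_map_π, coinducedι_π, Preadditive.sum_comp,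
    Finset.sum_eq_single q]
  · split_ifs <;> simp [coinducedι_π]
  · intro q' _ hq'
    split_ifs
    · rw [coinducedι_π, if_neg hq'.symm]
    · exact zero_comp
  · exact fun h => (h (Finset.mem_univ _)).elim

/-- The morphism from `I_i(M)` to `X` with given components. -/
def coinducedDesc (f : ∀ ⦃j : J⦄, (j ⟶ i) → (M ⟶ X.obj j)) (hf : IsCoinducedFamily X f) :
    (evaluationRightAdjoint A i).obj M ⟶ X where
  app j := ∑ p : j ⟶ i, coinducedπ M p ≫ f p
  naturality j k a := by
    classical
    simp only [Preadditive.comp_sum, Preadditive.sum_comp, Category.assoc, hf a, comp_ite,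
      comp_zero, reassoc_of% coinduced_map_π]
    rw [Finset.sum_comm]
    exact Finset.sum_congr rfl fun q _ => by rw [Finset.sum_ite_eq, if_pos (Finset.mem_univ _)]

lemma coinducedι_desc (f : ∀ ⦃j : J⦄, (j ⟶ i) → (M ⟶ X.obj j)) (hf : IsCoinducedFamily X f)
    {j : J} (p : j ⟶ i) : coinducedι M p ≫ (coinducedDesc f hf).app j = f p := by
  classical
  change coinducedι M p ≫ ∑ q : j ⟶ i, coinducedπ M q ≫ f q = f p
  simp only [Preadditive.comp_sum, reassoc_of% coinducedι_π, ite_comp, Category.id_comp, zero_comp]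
  rw [Finset.sum_ite_eq', if_pos (Finset.mem_univ _)]

lemma isCoinducedFamily_of_hom (φ : (evaluationRightAdjoint A i).obj M ⟶ X) :
    IsCoinducedFamily X fun j (p : j ⟶ i) => coinducedι M p ≫ φ.app j := by
  intro j k a p
  rw [Category.assoc, ← φ.naturality, reassoc_of% coinducedι_map, Preadditive.sum_comp]
  simp only [ite_comp, zero_comp]

variable [Finite J]

/-- The functor `M ↦ Hom(I_i(M), X)` is represented by an object `R` of `A`, namely by a kernel of
a morphism between finite products of values of `X`. -/
lemma exists_universal_coinducedFamily (X : J ⥤ A) (i : J) :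
    ∃ (R : A) (r : ∀ ⦃j : J⦄, (j ⟶ i) → (R ⟶ X.obj j)), IsCoinducedFamily X r ∧
      ∀ (M : A) (f : ∀ ⦃j : J⦄, (j ⟶ i) → (M ⟶ X.obj j)), IsCoinducedFamily X f →
        ∃ g : M ⟶ R, ∀ ⦃j : J⦄ (p : j ⟶ i), g ≫ r p = f p := by
  classical
  let W (x : Σ j, (j ⟶ i)) : A := X.obj x.1
  let V (y : Σ x : (Σ j, (j ⟶ i)), Σ k, (x.1 ⟶ k)) : A := X.obj y.2.1
  let d : (⨁ W) ⟶ ⨁ V := biproduct.lift fun y =>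
    biproduct.π W y.1 ≫ X.map y.2.2 -
      ∑ q : y.2.1 ⟶ i, if y.2.2 ≫ q = y.1.2 then biproduct.π W ⟨_, q⟩ else 0
  have hd {N : A} (g : N ⟶ ⨁ W) : g ≫ d = 0 ↔
      IsCoinducedFamily X fun j (p : j ⟶ i) => g ≫ biproduct.π W ⟨j, p⟩ := by
    have key (y) : (g ≫ d) ≫ biproduct.π V y = (g ≫ biproduct.π W y.1) ≫ X.map y.2.2 -
        ∑ q : y.2.1 ⟶ i, if y.2.2 ≫ q = y.1.2 then g ≫ biproduct.π W ⟨_, q⟩ else 0 := by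
      simp only [d, Category.assoc, biproduct.lift_π, Preadditive.comp_sub, Preadditive.comp_sum,
        comp_ite, comp_zero]
    constructor
    · intro h j k a p
      have := key ⟨⟨j, p⟩, ⟨k, a⟩⟩
      rw [h, zero_comp] at this
      exact sub_eq_zero.1 this.symm
    · intro h
      ext y
      rw [key, zero_comp]
      exact sub_eq_zero.2 (h y.2.2 y.1.2)
  refine ⟨kernel d, fun j p => kernel.ι d ≫ biproduct.π W ⟨j, p⟩, (hd _).1 (kernel.condition d),
    fun M f hf => ?_⟩
  have : biproduct.lift (fun x => f x.2) ≫ d = 0 := (hd _).2 (by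
    convert hf using 3
    exact biproduct.lift_π _ _)
  exact ⟨kernel.lift d _ this, fun j p => by
    rw [kernel.lift_ι_assoc, biproduct.lift_π]⟩

/-- Covering the object representing `Hom(I_i(-), X)` by a projective object yields an approximation
of `X` by objects coinduced from projective objects. -/
lemma exists_coinduced_approximation [EnoughProjectives A] (X : J ⥤ A) (i : J) :
    ∃ (P : A) (φ : (evaluationRightAdjoint A i).obj P ⟶ X), Projective P ∧
      ∀ (P' : A) (f : (evaluationRightAdjoint A i).obj P' ⟶ X), Projective P' →
        ∃ g : (evaluationRightAdjoint A i).obj P' ⟶ (evaluationRightAdjoint A i).obj P,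
          g ≫ φ = f := by
  obtain ⟨R, r, hr, hR⟩ := exists_universal_coinducedFamily X i
  have hr' : IsCoinducedFamily X fun j (p : j ⟶ i) => Projective.π R ≫ r p := fun j k a p => by
    rw [Category.assoc, hr a p, Preadditive.comp_sum]
    simp only [comp_ite, comp_zero]
  refine ⟨Projective.over R, coinducedDesc _ hr', inferInstance, fun P' f hP' => ?_⟩
  obtain ⟨g, hg⟩ := hR P' _ (isCoinducedFamily_of_hom f)
  refine ⟨(evaluationRightAdjoint A i).map (Projective.factorThru g (Projective.π R)), ?_⟩
  ext j : 2
  refine coinduced_hom_ext' fun p => ?_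
  rw [NatTrans.comp_app, reassoc_of% coinducedι_app, coinducedι_desc,
    Projective.factorThru_comp_assoc, hg]

end Families

/-! ### Morphisms into induced functors -/

section Families

variable {J : Type w} [Category.{w'} J] [∀ i j : J, Fintype (i ⟶ j)]
variable {A : Type u} [Category.{v} A] [Abelian A]

open Classical in
/-- The condition under which morphisms `f p : X_j ⟶ M`, indexed by the morphisms `p : i ⟶ j`, are
the components of a morphism from `X` to `P_i(M) = ⨁_{i ⟶ j} M`. -/
def IsInducedFamily (X : J ⥤ A) {i : J} {M : A} (f : ∀ ⦃j : J⦄, (i ⟶ j) → (X.obj j ⟶ M)) :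
    Prop :=
  ∀ ⦃j k : J⦄ (a : j ⟶ k) (q : i ⟶ k),
    X.map a ≫ f q = ∑ p : i ⟶ j, if p ≫ a = q then f p else 0

variable {X : J ⥤ A} {i : J} {M : A}

/-- The inclusion of the summand of `P_i(M)_j` indexed by `p : i ⟶ j`. -/
def inducedι (M : A) {j : J} (p : i ⟶ j) :
    M ⟶ ((evaluationLeftAdjoint A i).obj M).obj j :=
  Sigma.ι (fun _ : i ⟶ j => M) p

open Classical in
/-- The projection of `P_i(M)_j` onto the summand indexed by `p : i ⟶ j`. -/
def inducedπ (M : A) {j : J} (p : i ⟶ j) :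
    ((evaluationLeftAdjoint A i).obj M).obj j ⟶ M :=
  Sigma.desc fun q => if q = p then 𝟙 M else 0

lemma induced_hom_ext {j : J} {Z : A} {f g : ((evaluationLeftAdjoint A i).obj M).obj j ⟶ Z}
    (h : ∀ p : i ⟶ j, inducedι M p ≫ f = inducedι M p ≫ g) : f = g :=
  Sigma.hom_ext _ _ h

open Classical in
lemma inducedι_π {j : J} (p q : i ⟶ j) :
    inducedι M q ≫ inducedπ M p = if q = p then 𝟙 M else 0 :=
  Sigma.ι_desc _ _

lemma inducedι_map {j k : J} (p : i ⟶ j) (a : j ⟶ k) :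
    inducedι M p ≫ ((evaluationLeftAdjoint A i).obj M).map a = inducedι M (p ≫ a) :=
  Sigma.ι_desc _ _

lemma inducedι_app {N : A} (f : M ⟶ N) {j : J} (p : i ⟶ j) :
    inducedι M p ≫ ((evaluationLeftAdjoint A i).map f).app j = f ≫ inducedι N p :=
  Sigma.ι_desc _ _

lemma induced_total (j : J) :
    ∑ p : i ⟶ j, inducedπ M p ≫ inducedι M p =
      𝟙 (((evaluationLeftAdjoint A i).obj M).obj j) := by
  classical
  refine induced_hom_ext fun q => ?_
  rw [Preadditive.comp_sum]
  simp only [reassoc_of% inducedι_π, ite_comp, zero_comp]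
  rw [Finset.sum_ite_eq, if_pos (Finset.mem_univ _), Category.comp_id, Category.id_comp]

lemma induced_hom_ext' {j : J} {Z : A} {f g : Z ⟶ ((evaluationLeftAdjoint A i).obj M).obj j}
    (h : ∀ p : i ⟶ j, f ≫ inducedπ M p = g ≫ inducedπ M p) : f = g := by
  rw [← Category.comp_id f, ← Category.comp_id g, ← induced_total, Preadditive.comp_sum,
    Preadditive.comp_sum]
  simp only [reassoc_of% h]

lemma induced_app_π {N : A} (f : M ⟶ N) {j : J} (p : i ⟶ j) :
    ((evaluationLeftAdjoint A i).map f).app j ≫ inducedπ N p = inducedπ M p ≫ f := by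
  classical
  refine induced_hom_ext fun q => ?_
  rw [reassoc_of% inducedι_app, inducedι_π, reassoc_of% inducedι_π]
  split_ifs <;> simp

open Classical in
lemma induced_map_π {j k : J} (a : j ⟶ k) (q : i ⟶ k) :
    ((evaluationLeftAdjoint A i).obj M).map a ≫ inducedπ M q =
      ∑ p : i ⟶ j, if p ≫ a = q then inducedπ M p else 0 := by
  refine induced_hom_ext fun p => ?_
  rw [reassoc_of% inducedι_map, inducedι_π, Preadditive.comp_sum, Finset.sum_eq_single p]
  · split_ifs <;> simp [inducedι_π]
  · intro p' _ hp'
    split_ifs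
    · rw [inducedι_π, if_neg hp'.symm]
    · exact comp_zero
  · exact fun h => (h (Finset.mem_univ _)).elim

/-- The morphism from `X` to `P_i(M)` with given components. -/
def inducedLift (f : ∀ ⦃j : J⦄, (i ⟶ j) → (X.obj j ⟶ M)) (hf : IsInducedFamily X f) :
    X ⟶ (evaluationLeftAdjoint A i).obj M where
  app j := ∑ p : i ⟶ j, f p ≫ inducedι M p
  naturality j k a := by
    classical
    simp only [Preadditive.comp_sum, Preadditive.sum_comp, Category.assoc,
      reassoc_of% (fun q => hf a q), ite_comp, zero_comp, inducedι_map]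
    rw [Finset.sum_comm]
    exact Finset.sum_congr rfl fun p _ => by rw [Finset.sum_ite_eq, if_pos (Finset.mem_univ _)]

lemma inducedLift_π (f : ∀ ⦃j : J⦄, (i ⟶ j) → (X.obj j ⟶ M)) (hf : IsInducedFamily X f)
    {j : J} (p : i ⟶ j) : (inducedLift f hf).app j ≫ inducedπ M p = f p := by
  classical
  change (∑ q : i ⟶ j, f q ≫ inducedι M q) ≫ inducedπ M p = f p
  simp only [Preadditive.sum_comp, Category.assoc, inducedι_π, comp_ite, Category.comp_id,
    comp_zero]
  rw [Finset.sum_ite_eq', if_pos (Finset.mem_univ _)]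

lemma isInducedFamily_of_hom (φ : X ⟶ (evaluationLeftAdjoint A i).obj M) :
    IsInducedFamily X fun j (p : i ⟶ j) => φ.app j ≫ inducedπ M p := by
  intro j k a q
  rw [φ.naturality_assoc, induced_map_π, Preadditive.comp_sum]
  simp only [comp_ite, comp_zero]

variable [Finite J]

/-- The functor `M ↦ Hom(X, P_i(M))` is corepresented by an object `R` of `A`, namely by a cokernel
of a morphism between finite sums of values of `X`. -/
lemma exists_universal_inducedFamily (X : J ⥤ A) (i : J) :
    ∃ (R : A) (r : ∀ ⦃j : J⦄, (i ⟶ j) → (X.obj j ⟶ R)), IsInducedFamily X r ∧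
      ∀ (M : A) (f : ∀ ⦃j : J⦄, (i ⟶ j) → (X.obj j ⟶ M)), IsInducedFamily X f →
        ∃ g : R ⟶ M, ∀ ⦃j : J⦄ (p : i ⟶ j), r p ≫ g = f p := by
  classical
  let W (x : Σ j, (i ⟶ j)) : A := X.obj x.1
  let V (y : Σ x : (Σ k, (i ⟶ k)), Σ j, (j ⟶ x.1)) : A := X.obj y.2.1
  let d : (⨁ V) ⟶ ⨁ W := biproduct.desc fun y =>
    X.map y.2.2 ≫ biproduct.ι W y.1 -
      ∑ p : i ⟶ y.2.1, if p ≫ y.2.2 = y.1.2 then biproduct.ι W ⟨_, p⟩ else 0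
  have hd {N : A} (g : (⨁ W) ⟶ N) : d ≫ g = 0 ↔
      IsInducedFamily X fun j (p : i ⟶ j) => biproduct.ι W ⟨j, p⟩ ≫ g := by
    have key (y) : biproduct.ι V y ≫ d ≫ g = X.map y.2.2 ≫ biproduct.ι W y.1 ≫ g -
        ∑ p : i ⟶ y.2.1, if p ≫ y.2.2 = y.1.2 then biproduct.ι W ⟨_, p⟩ ≫ g else 0 := by
      simp only [d, biproduct.ι_desc_assoc, Preadditive.sub_comp, Preadditive.sum_comp,
        Category.assoc, ite_comp, zero_comp]
    constructor
    · intro h j k a q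
      have := key ⟨⟨k, q⟩, ⟨j, a⟩⟩
      rw [h, comp_zero] at this
      exact sub_eq_zero.1 this.symm
    · intro h
      ext y
      rw [key, comp_zero]
      exact sub_eq_zero.2 (h y.2.2 y.1.2)
  refine ⟨cokernel d, fun j p => biproduct.ι W ⟨j, p⟩ ≫ cokernel.π d,
    (hd _).1 (cokernel.condition d), fun M f hf => ?_⟩
  have : d ≫ biproduct.desc (fun x => f x.2) = 0 := (hd _).2 (by
    convert hf using 3
    exact biproduct.ι_desc _ _)
  exact ⟨cokernel.desc d _ this, fun j p => by
    rw [Category.assoc, cokernel.π_desc, biproduct.ι_desc]⟩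

/-- Embedding the object corepresenting `Hom(X, P_i(-))` into an injective object yields an
approximation of `X` by objects induced from injective objects. -/
lemma exists_induced_approximation [EnoughInjectives A] (X : J ⥤ A) (i : J) :
    ∃ (I : A) (ψ : X ⟶ (evaluationLeftAdjoint A i).obj I), Injective I ∧
      ∀ (I' : A) (f : X ⟶ (evaluationLeftAdjoint A i).obj I'), Injective I' →
        ∃ g : (evaluationLeftAdjoint A i).obj I ⟶ (evaluationLeftAdjoint A i).obj I',
          ψ ≫ g = f := by
  obtain ⟨R, r, hr, hR⟩ := exists_universal_inducedFamily X i
  have hr' : IsInducedFamily X fun j (p : i ⟶ j) => r p ≫ Injective.ι R := fun j k a q => by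
    rw [reassoc_of% hr a q, Preadditive.sum_comp]
    simp only [ite_comp, zero_comp]
  refine ⟨Injective.under R, inducedLift _ hr', inferInstance, fun I' f hI' => ?_⟩
  obtain ⟨g, hg⟩ := hR I' _ (isInducedFamily_of_hom f)
  refine ⟨(evaluationLeftAdjoint A i).map (Injective.factorThru g (Injective.ι R)), ?_⟩
  ext j : 2
  refine induced_hom_ext' fun p => ?_
  rw [NatTrans.comp_app, Category.assoc, induced_app_π, reassoc_of% inducedLift_π,
    Category.assoc, Injective.comp_factorThru, hg]

end Families

/-! ### Projective and injective values of functors -/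

section Values

variable {E : Type u} [Category.{v} E] [Abelian E]

lemma projective_biproduct {ι : Type*} [Finite ι] (F : ι → E) (hF : ∀ k, Projective (F k)) :
    Projective (⨁ F) where
  factors f e _ := ⟨biproduct.desc fun k => Projective.factorThru (biproduct.ι F k ≫ f) e, by
    ext; simp⟩

lemma injective_biproduct {ι : Type*} [Finite ι] (F : ι → E) (hF : ∀ k, Injective (F k)) :
    Injective (⨁ F) where
  factors f e _ := ⟨biproduct.lift fun k => Injective.factorThru (f ≫ biproduct.π F k) e, by
    ext; simp⟩

variable {J : Type w} [Category.{w'} J] {A : Type u} [Category.{v} A] [Abelian A]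

lemma projective_obj_of_addClosure {S : ObjectProperty (J ⥤ A)} (j : J)
    (hS : ∀ X, S X → Projective (X.obj j)) (X : J ⥤ A) (hX : addClosure S X) :
    Projective (X.obj j) := by
  obtain ⟨Y, ⟨n, F, hF, ⟨e⟩⟩, ⟨r⟩⟩ := hX
  have : Projective ((⨁ F).obj j) :=
    Projective.of_iso (((evaluation J A).obj j).mapBiproduct F).symm
      (projective_biproduct _ fun k => hS _ (hF k))
  exact ((r.trans (Retract.ofIso e)).map ((evaluation J A).obj j)).projective (p := this)

lemma injective_obj_of_addClosure {S : ObjectProperty (J ⥤ A)} (j : J)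
    (hS : ∀ X, S X → Injective (X.obj j)) (X : J ⥤ A) (hX : addClosure S X) :
    Injective (X.obj j) := by
  obtain ⟨Y, ⟨n, F, hF, ⟨e⟩⟩, ⟨r⟩⟩ := hX
  have : Injective ((⨁ F).obj j) :=
    Injective.of_iso (((evaluation J A).obj j).mapBiproduct F).symm
      (injective_biproduct _ fun k => hS _ (hF k))
  exact ((r.trans (Retract.ofIso e)).map ((evaluation J A).obj j)).injective (i := this)

variable [∀ i j : J, Finite (i ⟶ j)]

lemma projective_evaluationRightAdjoint_obj_obj (i j : J) (P : A) (hP : Projective P) :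
    Projective (((evaluationRightAdjoint A i).obj P).obj j) :=
  Projective.of_iso (biproduct.isoProduct fun _ : j ⟶ i => P) (projective_biproduct _ fun _ => hP)

lemma injective_evaluationLeftAdjoint_obj_obj (i j : J) (I : A) (hI : Injective I) :
    Injective (((evaluationLeftAdjoint A i).obj I).obj j) :=
  Injective.of_iso (biproduct.isoCoproduct fun _ : i ⟶ j => I) (injective_biproduct _ fun _ => hI)

lemma projective_evaluationLeftAdjoint_obj (j : J) (P : A) (hP : Projective P) :
    Projective ((evaluationLeftAdjoint A j).obj P) :=
  have : ((evaluation J A).obj j).PreservesEpimorphisms :=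
    ⟨fun f hf => (NatTrans.epi_iff_epi_app f).1 hf j⟩
  (evaluationAdjunctionRight A j).map_projective P hP

lemma injective_evaluationRightAdjoint_obj (j : J) (I : A) (hI : Injective I) :
    Injective ((evaluationRightAdjoint A j).obj I) :=
  have : ((evaluation J A).obj j).PreservesMonomorphisms :=
    ⟨fun f hf => (NatTrans.mono_iff_mono_app f).1 hf j⟩
  (evaluationAdjunctionLeft A j).map_injective I hI

lemma projective_obj_of_projective {P : J ⥤ A} (hP : Projective P) (j : J) :
    Projective (P.obj j) := by
  have (i j : J) : Fintype (i ⟶ j) := Fintype.ofFinite _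
  have : (evaluationRightAdjoint A j).PreservesEpimorphisms := ⟨fun f hf =>
    (NatTrans.epi_iff_epi_app _).2 fun k => ⟨fun a b hab => coinduced_hom_ext' fun p => by
      rw [← cancel_epi f, ← reassoc_of% coinducedι_app, hab, reassoc_of% coinducedι_app]⟩⟩
  exact (evaluationAdjunctionLeft A j).map_projective P hP

lemma injective_obj_of_injective {I : J ⥤ A} (hI : Injective I) (j : J) :
    Injective (I.obj j) := by
  have (i j : J) : Fintype (i ⟶ j) := Fintype.ofFinite _
  have : (evaluationLeftAdjoint A j).PreservesMonomorphisms := ⟨fun f hf =>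
    (NatTrans.mono_iff_mono_app _).2 fun k => ⟨fun a b hab => induced_hom_ext' fun p => by
      rw [← cancel_mono f, Category.assoc, Category.assoc, ← induced_app_π, reassoc_of% hab]⟩⟩
  exact (evaluationAdjunctionRight A j).map_injective I hI

/-- Morphisms to `I_j(N)` extend along a monomorphism whose cokernel is projective at `j`. -/
lemma exists_extension_to_coinduced {K L X : J ⥤ A} {i : K ⟶ L} {p : L ⟶ X} (h : IsSES i p)
    (j : J) (hX : Projective (X.obj j)) {N : A} (f : K ⟶ (evaluationRightAdjoint A j).obj N) :
    ∃ g : L ⟶ (evaluationRightAdjoint A j).obj N, i ≫ g = f := by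
  have := (h.app j).epi
  obtain ⟨r, hr, -⟩ := (h.app j).exists_retraction (Projective.factorThru_comp (𝟙 _) (p.app j))
  let e {F : J ⥤ A} := (evaluationAdjunctionLeft A j).homEquiv F N
  refine ⟨e (r ≫ e.symm f), ?_⟩
  have := (evaluationAdjunctionLeft A j).homEquiv_naturality_left i (r ≫ e.symm f)
  refine this.symm.trans ?_
  have h' : i.app j ≫ r ≫ e.symm f = e.symm f := by rw [reassoc_of% hr]
  exact (congr_arg e h').trans (Equiv.apply_symm_apply _ _)

/-- Morphisms from `P_j(N)` lift along an epimorphism whose kernel is injective at `j`. -/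
lemma exists_lifting_of_induced {X L K : J ⥤ A} {i : X ⟶ L} {p : L ⟶ K} (h : IsSES i p)
    (j : J) (hX : Injective (X.obj j)) {N : A} (f : (evaluationLeftAdjoint A j).obj N ⟶ K) :
    ∃ g : (evaluationLeftAdjoint A j).obj N ⟶ L, g ≫ p = f := by
  have := (h.app j).mono
  obtain ⟨s, hs, -⟩ := (h.app j).exists_section (Injective.comp_factorThru (𝟙 _) (i.app j))
  let e {F : J ⥤ A} := (evaluationAdjunctionRight A j).homEquiv N F
  refine ⟨e.symm (e f ≫ s), ?_⟩
  have := (evaluationAdjunctionRight A j).homEquiv_naturality_right_symm (e f ≫ s) p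
  refine this.symm.trans ?_
  have h' : (e f ≫ s) ≫ p.app j = e f :=
    (Category.assoc _ _ _).trans ((congr_arg _ hs).trans (Category.comp_id _))
  exact (congr_arg e.symm h').trans (Equiv.symm_apply_apply _ _)

end Values

/-! ### Covers by induced and embeddings into coinduced functors -/

section Covers

variable {J : Type w} [Category.{w'} J] [Finite J] [∀ i j : J, Finite (i ⟶ j)]
variable {A : Type u} [Category.{v} A] [Abelian A]

/-- The morphism `⨁_j P_j(M_j) ⟶ X` attached to a family of morphisms `M_j ⟶ X_j`. -/
def inducedCover (X : J ⥤ A) {M : J → A} (π : ∀ j, M j ⟶ X.obj j) :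
    (⨁ fun j => (evaluationLeftAdjoint A j).obj (M j)) ⟶ X :=
  biproduct.desc fun j => ((evaluationAdjunctionRight A j).homEquiv _ _).symm (π j)

/-- The morphism `X ⟶ ⨁_j I_j(M_j)` attached to a family of morphisms `X_j ⟶ M_j`. -/
def coinducedEmbedding (X : J ⥤ A) {M : J → A} (f : ∀ j, X.obj j ⟶ M j) :
    X ⟶ ⨁ fun j => (evaluationRightAdjoint A j).obj (M j) :=
  biproduct.lift fun j => (evaluationAdjunctionLeft A j).homEquiv _ _ (f j)

/-- The component of `inducedCover X π` at `j` factors `π j`. -/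
lemma exists_comp_inducedCover_app (X : J ⥤ A) {M : J → A} (π : ∀ j, M j ⟶ X.obj j) (j : J) :
    ∃ s, s ≫ (inducedCover X π).app j = π j := by
  refine ⟨(evaluationAdjunctionRight A j).unit.app (M j) ≫
    (biproduct.ι (fun j => (evaluationLeftAdjoint A j).obj (M j)) j).app j, ?_⟩
  rw [Category.assoc, ← NatTrans.comp_app, inducedCover, biproduct.ι_desc]
  exact ((evaluationAdjunctionRight A j).homEquiv_unit _ _ _).symm.trans
    (Equiv.apply_symm_apply _ _)

/-- The component of `coinducedEmbedding X f` at `j` factors `f j`. -/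
lemma exists_coinducedEmbedding_app_comp (X : J ⥤ A) {M : J → A} (f : ∀ j, X.obj j ⟶ M j)
    (j : J) : ∃ r, (coinducedEmbedding X f).app j ≫ r = f j := by
  refine ⟨(biproduct.π (fun j => (evaluationRightAdjoint A j).obj (M j)) j).app j ≫
    (evaluationAdjunctionLeft A j).counit.app (M j), ?_⟩
  rw [← Category.assoc, ← NatTrans.comp_app, coinducedEmbedding, biproduct.lift_π]
  exact ((evaluationAdjunctionLeft A j).homEquiv_counit _ _ _).symm.trans
    (Equiv.symm_apply_apply _ _)

instance epi_inducedCover (X : J ⥤ A) {M : J → A} (π : ∀ j, M j ⟶ X.obj j) [∀ j, Epi (π j)] :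
    Epi (inducedCover X π) := by
  refine (NatTrans.epi_iff_epi_app _).2 fun j => ?_
  obtain ⟨s, hs⟩ := exists_comp_inducedCover_app X π j
  have : Epi (s ≫ (inducedCover X π).app j) := by rw [hs]; infer_instance
  exact epi_of_epi s _

instance mono_coinducedEmbedding (X : J ⥤ A) {M : J → A} (f : ∀ j, X.obj j ⟶ M j)
    [∀ j, Mono (f j)] : Mono (coinducedEmbedding X f) := by
  refine (NatTrans.mono_iff_mono_app _).2 fun j => ?_
  obtain ⟨r, hr⟩ := exists_coinducedEmbedding_app_comp X f j
  have : Mono ((coinducedEmbedding X f).app j ≫ r) := by rw [hr]; infer_instance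
  exact mono_of_mono _ r

lemma enoughProjectives_functor [EnoughProjectives A] : EnoughProjectives (J ⥤ A) where
  presentation X :=
    ⟨{ p := _
       projective := projective_biproduct _ fun j =>
         projective_evaluationLeftAdjoint_obj j (Projective.over (X.obj j)) inferInstance
       f := inducedCover X fun j => Projective.π (X.obj j) }⟩

lemma enoughInjectives_functor [EnoughInjectives A] : EnoughInjectives (J ⥤ A) where
  presentation X :=
    ⟨{ J := _
       injective := injective_biproduct _ fun j =>
         injective_evaluationRightAdjoint_obj j (Injective.under (X.obj j)) inferInstance
       f := coinducedEmbedding X fun j => Injective.ι (X.obj j) }⟩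

end Covers

/-! ### Representations of finite acyclic quivers -/

section Quiver

variable {Q : Type w} [Quiver.{w'} Q] [Finite Q] [∀ i j : Q, Finite (i ⟶ j)] [IsAcyclicQuiver Q]
variable {A : Type u} [Category.{v} A] [Abelian A]

instance : Finite (Paths Q) := inferInstanceAs (Finite Q)

variable (Q A)

/-- The properties of representations that enter the tilting theorem. A representation `X` that is
projective at every vertex embeds into `⨁_i I_i(X_i)`, and the embedding splits at every vertex. -/
theorem isTiltingFrame_repProj [EnoughProjectives A] :
    IsTiltingFrame (repProj Q A) (tiltingT Q A) where
  le X hX i := projective_obj_of_addClosure _ (by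
    rintro _ ⟨k, P, hP, rfl⟩
    exact projective_evaluationRightAdjoint_obj_obj _ _ P hP) X hX
  add_closed _ hX := addClosure_addClosure hX
  of_retract r hY i :=
    (r.map ((evaluation (Paths Q) A).obj ((Paths.of Q).obj i))).projective (p := hY i)
  of_isSES h hX hZ i := (h.app _).projective (hX i) (hZ i)
  of_projective _ hP _ := projective_obj_of_projective hP _
  projDim_le_one X hX := by
    have := enoughProjectives_functor (J := Paths Q) (A := A)
    have hS := IsSES.of_epi (Projective.π X)
    exact ⟨_, _, _, _, hS.projective_of_ext_lifting hX.exists_ext_lifting,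
      inferInstance, hS⟩
  ext_vanishes X Y hX hY := by
    have := enoughProjectives_functor (J := Paths Q) (A := A)
    have hS := IsSES.of_epi (Projective.π X)
    refine ExtOneVanishes.of_projective hS fun f => exists_extension_of_addClosure _ ?_ Y f hY
    rintro _ f ⟨i, P, -, rfl⟩
    exact exists_extension_to_coinduced hS _ (hX i) f
  exists_embedding X hX := by
    let j := coinducedEmbedding X fun i : Paths Q => 𝟙 (X.obj i)
    have hT : tiltingT Q A (⨁ fun i : Paths Q => (evaluationRightAdjoint A i).obj (X.obj i)) :=
      (isFiniteSumOf_biproduct _ fun i => ⟨i, X.obj i, hX i, rfl⟩).addClosure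
    suffices h : ∀ i : Paths Q, Projective ((cokernel j).obj i) from
      ⟨_, _, j, cokernel.π j, hT, fun i => h i, IsSES.of_mono j⟩
    intro i
    -- The embedding splits at every vertex, so its cokernel is a summand there.
    obtain ⟨r, hr⟩ := exists_coinducedEmbedding_app_comp X (fun i : Paths Q => 𝟙 (X.obj i)) i
    obtain ⟨s, hs, -⟩ := ((IsSES.of_mono j).app i).exists_section hr
    refine Retract.projective ⟨s, _, hs⟩ (p := projective_obj_of_addClosure i ?_ _ hT)
    rintro _ ⟨k, P, hP, rfl⟩
    exact projective_evaluationRightAdjoint_obj_obj _ _ P hP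
  contravariantlyFinite X := by
    have (i j : Paths Q) : Fintype (i ⟶ j) := Fintype.ofFinite _
    choose P φ hP hφ using fun i : Paths Q => exists_coinduced_approximation X i
    refine ⟨⨁ fun i => (evaluationRightAdjoint A i).obj (P i), biproduct.desc φ,
      (isFiniteSumOf_biproduct _ fun i => ⟨i, P i, hP i, rfl⟩).addClosure, fun X' f hX' =>
      exists_lifting_of_addClosure _ ?_ X' f hX'⟩
    rintro _ f ⟨i, P', hP', rfl⟩
    obtain ⟨g, hg⟩ := hφ i P' f hP'
    exact ⟨g ≫ biproduct.ι (fun i => (evaluationRightAdjoint A i).obj (P i)) i,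
      (Category.assoc _ _ _).trans ((congr_arg _ (biproduct.ι_desc _ _)).trans hg)⟩

/-- The properties of representations that enter the cotilting theorem. A representation `X` that is
injective at every vertex is a quotient of `⨁_i P_i(X_i)`, and the quotient map splits at every
vertex. -/
theorem isCotiltingFrame_repInj [EnoughInjectives A] :
    IsCotiltingFrame (repInj Q A) (cotiltingC Q A) where
  le X hX i := injective_obj_of_addClosure _ (by
    rintro _ ⟨k, I, hI, rfl⟩
    exact injective_evaluationLeftAdjoint_obj_obj _ _ I hI) X hX
  add_closed _ hX := addClosure_addClosure hX
  of_retract r hY i :=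
    (r.map ((evaluation (Paths Q) A).obj ((Paths.of Q).obj i))).injective (i := hY i)
  of_isSES h hX hZ i := (h.app _).injective (hX i) (hZ i)
  of_injective _ hI _ := injective_obj_of_injective hI _
  injDim_le_one X hX := by
    have := enoughInjectives_functor (J := Paths Q) (A := A)
    have hS := IsSES.of_mono (Injective.ι X)
    exact ⟨_, _, _, _, inferInstance,
      hS.injective_of_ext_extension hX.exists_ext_extension, hS⟩
  ext_vanishes X Y hX hY := by
    have := enoughInjectives_functor (J := Paths Q) (A := A)
    have hS := IsSES.of_mono (Injective.ι Y)
    refine ExtOneVanishes.of_injective hS fun f => exists_lifting_of_addClosure _ ?_ X f hX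
    rintro _ f ⟨i, I, -, rfl⟩
    exact exists_lifting_of_induced hS _ (hY i) f
  exists_cover X hX := by
    let p := inducedCover X fun i : Paths Q => 𝟙 (X.obj i)
    have hC : cotiltingC Q A (⨁ fun i : Paths Q => (evaluationLeftAdjoint A i).obj (X.obj i)) :=
      (isFiniteSumOf_biproduct _ fun i => ⟨i, X.obj i, hX i, rfl⟩).addClosure
    suffices h : ∀ i : Paths Q, Injective ((kernel p).obj i) from
      ⟨_, _, kernel.ι p, p, fun i => h i, hC, IsSES.of_epi p⟩
    intro i
    -- The cover splits at every vertex, so its kernel is a summand there.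
    obtain ⟨s, hs⟩ := exists_comp_inducedCover_app X (fun i : Paths Q => 𝟙 (X.obj i)) i
    obtain ⟨r, hr, -⟩ := ((IsSES.of_epi p).app i).exists_retraction hs
    refine Retract.injective ⟨_, r, hr⟩ (i := injective_obj_of_addClosure i ?_ _ hC)
    rintro _ ⟨k, I, hI, rfl⟩
    exact injective_evaluationLeftAdjoint_obj_obj _ _ I hI
  covariantlyFinite X := by
    have (i j : Paths Q) : Fintype (i ⟶ j) := Fintype.ofFinite _
    choose I ψ hI hψ using fun i : Paths Q => exists_induced_approximation X i
    refine ⟨⨁ fun i => (evaluationLeftAdjoint A i).obj (I i), biproduct.lift ψ,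
      (isFiniteSumOf_biproduct _ fun i => ⟨i, I i, hI i, rfl⟩).addClosure, fun X' f hX' =>
      exists_extension_of_addClosure _ ?_ X' f hX'⟩
    rintro _ f ⟨i, I', hI', rfl⟩
    obtain ⟨g, hg⟩ := hψ i I' f hI'
    exact ⟨biproduct.π (fun i => (evaluationLeftAdjoint A i).obj (I i)) i ≫ g,
      (Category.assoc _ _ _).symm.trans ((congr_arg (· ≫ g) (biproduct.lift_π ψ i)).trans hg)⟩

end Quiver

end QuiverTilting

end

theorem mainTheorem6
    (Q : Type w) [Quiver.{w'} Q] [Finite Q] [∀ i j : Q, Finite (i ⟶ j)] [IsAcyclicQuiver Q]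
    (A : Type u) [Category.{v} A] [Abelian A] :
    (EnoughProjectives A →
      EnoughProjectives (QRep Q A) ∧
      IsTilting (tiltingT Q A) ∧
      leftExtOrthogonal (tiltingT Q A) ⊓ ProjDimLEOne = repProj Q A ∧
      IsCotorsionPair (repProj Q A) (FacCat (tiltingT Q A)) ∧
      IsTorsionPair (FacCat (tiltingT Q A)) (tiltingT Q A).rightOrthogonal ∧
      repProj Q A ⊓ FacCat (tiltingT Q A) = tiltingT Q A ∧
      (∃ f, IsTorsionFreePart (FacCat (tiltingT Q A)) (tiltingT Q A).rightOrthogonal f) ∧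
      (∃ c, IsCotorsionPart (repProj Q A) (FacCat (tiltingT Q A)) (tiltingT Q A) c) ∧
      ∀ (f : QRep Q A ⥤ (tiltingT Q A).rightOrthogonal.FullSubcategory)
        (c : QRep Q A ⥤ AddQuotient (repProj Q A) (tiltingT Q A)),
        IsTorsionFreePart (FacCat (tiltingT Q A)) (tiltingT Q A).rightOrthogonal f →
        IsCotorsionPart (repProj Q A) (FacCat (tiltingT Q A)) (tiltingT Q A) c →
        ∃ e : AddQuotient (repProj Q A) (tiltingT Q A) ≌
            (tiltingT Q A).rightOrthogonal.FullSubcategory,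
          Nonempty (toAddQuotient (repProj Q A) (tiltingT Q A) ⋙ e.functor ≅
            (repProj Q A).ι ⋙ f) ∧
          Nonempty (e.inverse ≅ (tiltingT Q A).rightOrthogonal.ι ⋙ c)) ∧
    (EnoughInjectives A →
      EnoughInjectives (QRep Q A) ∧
      IsCotilting (cotiltingC Q A) ∧
      rightExtOrthogonal (cotiltingC Q A) ⊓ InjDimLEOne = repInj Q A ∧
      IsTorsionPair (cotiltingC Q A).leftOrthogonal (SubCat (cotiltingC Q A)) ∧
      IsCotorsionPair (SubCat (cotiltingC Q A)) (repInj Q A) ∧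
      SubCat (cotiltingC Q A) ⊓ repInj Q A = cotiltingC Q A ∧
      (∃ t, IsTorsionPart (cotiltingC Q A).leftOrthogonal (SubCat (cotiltingC Q A)) t) ∧
      (∃ d, IsCotorsionFreePart (SubCat (cotiltingC Q A)) (repInj Q A) (cotiltingC Q A) d) ∧
      ∀ (t : QRep Q A ⥤ (cotiltingC Q A).leftOrthogonal.FullSubcategory)
        (d : QRep Q A ⥤ AddQuotient (repInj Q A) (cotiltingC Q A)),
        IsTorsionPart (cotiltingC Q A).leftOrthogonal (SubCat (cotiltingC Q A)) t →
        IsCotorsionFreePart (SubCat (cotiltingC Q A)) (repInj Q A) (cotiltingC Q A) d →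
        ∃ e : AddQuotient (repInj Q A) (cotiltingC Q A) ≌
            (cotiltingC Q A).leftOrthogonal.FullSubcategory,
          Nonempty (toAddQuotient (repInj Q A) (cotiltingC Q A) ⋙ e.functor ≅
            (repInj Q A).ι ⋙ t) ∧
          Nonempty (e.inverse ≅ (cotiltingC Q A).leftOrthogonal.ι ⋙ d)) := by
  refine ⟨fun _ => ?_, fun _ => ?_⟩
  · have := enoughProjectives_functor (J := Paths Q) (A := A)
    have h := isTiltingFrame_repProj Q A
    exact ⟨this, h.isTilting, h.leftExtOrthogonal_inf_projDimLEOne, h.isCotorsionPair,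
      h.isTorsionPair, h.inf_facCat, h.isTorsionPair.exists_torsionFreePart,
      h.exists_cotorsionPart h.isCotorsionPair, h.exists_equivalence⟩
  · have := enoughInjectives_functor (J := Paths Q) (A := A)
    have h := isCotiltingFrame_repInj Q A
    exact ⟨this, h.isCotilting, h.rightExtOrthogonal_inf_injDimLEOne, h.isTorsionPair,
      h.isCotorsionPair, h.subCat_inf, h.isTorsionPair.exists_torsionPart,
      h.exists_cotorsionFreePart h.isCotorsionPair, h.exists_equivalence⟩
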